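/- **Theorem (Lossless time discretization).** Let $\Delta t>0$, $K\in\mathbb N$, $T=K\Delta t$, $\mathcal T=[0,T]$, $\mathcal K=\{1,\dots,K\}$, and let $\mathcal T_k=[(k-1)\Delta t,k\Delta t)$ for $k\in\mathcal K$, where the last interval $\mathcal T_K$ also contains $T$. For $U\subseteq\mathbb R$ let $\mathcal L(\mathcal T,U)$ be the set of Riemann integrable functions $\mathcal T\to U$. For $\boldsymbol v\in\mathbb R^K$ let $L\boldsymbol v:\mathcal T\to\mathbb R$ be the function with $(L\boldsymbol v)(t)=v_k$ for $t\in\mathcal T_k$, and for a function $w$ on $\mathcal T$ let $(L^\dagger w)_k=\frac1{\Delta t}\int_{\mathcal T_k}w(t)\,\mathrm dt$. Write $[z]^+=\max\{z,0\}$ and $[z]^-=\max\{-z,0\}$. *Data.* Let $0<\gamma\le\Gamma\le T$, $\hat\Gamma\ge\Gamma$, $\hat\gamma\le\gamma$; efficiencies $\eta^+,\eta^-\in(0,1]$; a power demand for driving $d:\mathcal T\to\mathbb R_+$ and maximum charging and discharging powers $\bar y^+,\bar y^-:\mathcal T\to\mathbb R$ that both vanish at every $t$ with $d(t)>0$; state-of-charge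 limits $\underline y,\bar y\in\mathbb R$; intervals $\mathcal Y_0=[\underline y_0,\bar y_0]$ and $\hat{\mathcal Y}_0=[\underline{\hat y}_0,\hat{\bar y}_0]\ne\emptyset$ of initial states; a target $y^\star\in\mathbb R$ and a penalty parameter $p^\star\ge0$; integrable prices $p^b,p^r:\mathcal T\to\mathbb R$; and a set $\mathcal X\subseteq\mathcal L(\mathcal T,\mathbb R_+)$ of admissible bids. Assume: 1. There are $\boldsymbol d,\bar{\boldsymbol y}^+,\bar{\boldsymbol y}^-\in\mathbb R^K$ with $d=L\boldsymbol d$, $\bar y^\pm=L\bar{\boldsymbol y}^\pm$, and every $x\in\mathcal X$ is of the form $x=L\boldsymbol x$ with $\boldsymbol x\in\mathbb R^K$. 2. $\Gamma,\gamma,\hat\Gamma,\hat\gamma$ are positive integer multiples of $\Delta t$. *Continuous-time problem.* Let $y^\pm(x^b,x^r,\delta)=[x^b+\delta x^r]^\pm$ for real numbers $x^b,x^r,\delta$, and, for functions $x^b,x^r,\delta$ on $\mathcal T$, let $$y(x^b,x^r,\delta,y_0,t)=y_0+\int_0^t\Big(\eta^+y^+\big(x^b(s),x^r(s),\delta(s)\big)-\tfrac1{\eta^-}y^-\big(x^b(s),x^r(s),\delta(s)\big)-d(s)\Big)\mathrm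 ds,$$ $$c(x^b,x^r)=\int_{\mathcal T}\big(p^b(t)x^b(t)-p^r(t)x^r(t)\big)\mathrm dt,\qquad \mathcal D=\Big\{\delta\in\mathcal L(\mathcal T,[-1,1]):\int_{[t-\Gamma]^+}^t|\delta(s)|\,\mathrm ds\le\gamma\ \ \forall t\in\mathcal T\Big\},$$ and let $\hat{\mathcal D}$ be defined as $\mathcal D$, with $\hat\Gamma,\hat\gamma$ in place of $\Gamma,\gamma$. Problem (R) is to minimize $$c(x^b,x^r)+\max_{\delta\in\hat{\mathcal D},\,y_0\in\hat{\mathcal Y}_0}p^\star\,|y(x^b,x^r,\delta,y_0,T)-y^\star|$$ over $x^b,x^r\in\mathcal X$ subject to $y^+(x^b(t),x^r(t),\delta(t))\le\bar y^+(t)$, $y^-(x^b(t),x^r(t),\delta(t))\le\bar y^-(t)$ and $\underline y\le y(x^b,x^r,\delta,y_0,t)\le\bar y$ for all $\delta\in\mathcal D$, $t\in\mathcal T$, $y_0\in\mathcal Y_0$. *Discrete-time problem.* Let $\mathcal X_{\mathcal K}=L^\dagger\mathcal X$, $c_{\mathcal K}(\boldsymbol x^b,\boldsymbol x^r)=c(L\boldsymbol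 x^b,L\boldsymbol x^r)$, $$y_k(\boldsymbol x^b,\boldsymbol x^r,\boldsymbol\delta,y_0)=y_0+\Delta t\sum_{l=1}^k\Big(\eta^+y^+(x^b_l,x^r_l,\delta_l)-\tfrac1{\eta^-}y^-(x^b_l,x^r_l,\delta_l)-d_l\Big),\quad k=0,\dots,K,$$ $$\mathcal D_{\mathcal K}=\Big\{\boldsymbol\delta\in[-1,1]^K:\sum_{l=1+[k-\Gamma/\Delta t]^+}^k|\delta_l|\le\frac{\gamma}{\Delta t}\ \ \forall k\in\mathcal K\Big\},$$ and let $\hat{\mathcal D}_{\mathcal K}$ be defined as $\mathcal D_{\mathcal K}$, with $\hat\Gamma,\hat\gamma$ in place of $\Gamma,\gamma$. Problem (R$_{\mathcal K}$) is to minimize $$c_{\mathcal K}(\boldsymbol x^b,\boldsymbol x^r)+\max_{\boldsymbol\delta\in\hat{\mathcal D}_{\mathcal K},\,y_0\in\hat{\mathcal Y}_0}p^\star\,|y_K(\boldsymbol x^b,\boldsymbol x^r,\boldsymbol\delta,y_0)-y^\star|$$ over $\boldsymbol x^b,\boldsymbol x^r\in\mathcal X_{\mathcal K}$ subject to $y^+(x^b_k,x^r_k,\delta_k)\le\bar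 y^+_k$ and $y^-(x^b_k,x^r_k,\delta_k)\le\bar y^-_k$ for all $\boldsymbol\delta\in\mathcal D_{\mathcal K}$, $k\in\mathcal K$, and $\underline y\le y_k(\boldsymbol x^b,\boldsymbol x^r,\boldsymbol\delta,y_0)\le\bar y$ for all $\boldsymbol\delta\in\mathcal D_{\mathcal K}$, $k\in\mathcal K\cup\{0\}$, $y_0\in\mathcal Y_0$. *Conclusion.* The problems (R) and (R$_{\mathcal K}$) are equivalent: the maxima in both objective functions are attained for all admissible bids; the map $(\boldsymbol x^b,\boldsymbol x^r)\mapsto(L\boldsymbol x^b,L\boldsymbol x^r)$ is a bijection from the feasible set of (R$_{\mathcal K}$) onto the feasible set of (R); for all $\boldsymbol x^b,\boldsymbol x^r\in\mathcal X_{\mathcal K}$ the objective value of $(L\boldsymbol x^b,L\boldsymbol x^r)$ in (R) equals that of $(\boldsymbol x^b,\boldsymbol x^r)$ in (R$_{\mathcal K}$); hence the optimal values (infima in $[-\infty,\infty]$) coincide, and the same map is a bijection between the sets of optimal solutions. -/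

import Mathlib

open Set MeasureTheory

noncomputable section

namespace VehicleToGrid

/-- Functions on the planning horizon `[0, T]`. -/
abbrev Traj (T : ℝ) : Type := Icc (0 : ℝ) T → ℝ

/-- Extension of a function on `[0, T]` to the real line (by `0`); it is only ever integrated
over subintervals of `[0, T]`. -/
def extendZero {T : ℝ} (f : Traj T) : ℝ → ℝ := Function.extend Subtype.val f 0

/-- Riemann (Darboux) integrability on `[0, T]`: for every `ε > 0` there is a finite partition
`0 = p 0 ≤ p 1 ≤ ⋯ ≤ p n = T`, with lower bounds `m i` and upper bounds `M i` of `f` on the closed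
cells, for which the upper sum exceeds the lower sum by less than `ε`. -/
def RiemannIntegrable {T : ℝ} (f : Traj T) : Prop :=
  ∀ ε : ℝ, 0 < ε → ∃ (n : ℕ) (p m M : ℕ → ℝ),
    p 0 = 0 ∧ p n = T ∧ (∀ i < n, p i ≤ p (i + 1)) ∧
    (∀ i < n, ∀ t : Icc (0 : ℝ) T, p i ≤ (t : ℝ) → (t : ℝ) ≤ p (i + 1) →
      m i ≤ f t ∧ f t ≤ M i) ∧
    ∑ i ∈ Finset.range n, (M i - m i) * (p (i + 1) - p i) < ε

/-- The set of Riemann integrable functions from `[0, T]` to `U`. -/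
def riemannClass (T : ℝ) (U : Set ℝ) : Set (Traj T) :=
  {f | (∀ t, f t ∈ U) ∧ RiemannIntegrable f}

/-- The uncertainty set of frequency deviation trajectories with regulation cycle `Γ` and
activation period `γ`. -/
def deviationSet (T Γ γ : ℝ) : Set (Traj T) :=
  {δ | δ ∈ riemannClass T (Icc (-1) 1) ∧
    ∀ t : Icc (0 : ℝ) T, ∫ s in (max ((t : ℝ) - Γ) 0)..(t : ℝ), |extendZero δ s| ≤ γ}

/-- The discretized uncertainty set. The element `k : Fin K` stands for the period with
number `k + 1`, so the sum runs over the period numbers from `1 + [k + 1 - Γ / Δt]⁺`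
to `k + 1`. -/
def deviationSetK (K : ℕ) (Δt Γ γ : ℝ) : Set (Fin K → ℝ) :=
  {δ | (∀ k, δ k ∈ Icc (-1 : ℝ) 1) ∧
    ∀ k : Fin K,
      ∑ l ∈ Finset.univ.filter (fun l : Fin K =>
        1 + max (((k : ℕ) : ℝ) + 1 - Γ / Δt) 0 ≤ ((l : ℕ) : ℝ) + 1 ∧ l ≤ k), |δ l| ≤ γ / Δt}

/-- Charging rate. -/
def chargeRate (xb xr δ : ℝ) : ℝ := max (xb + δ * xr) 0

/-- Discharging rate. -/
def dischargeRate (xb xr δ : ℝ) : ℝ := max (-(xb + δ * xr)) 0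

/-- The data of the bidding problem. -/
structure Data where
  /-- length of the planning horizon -/
  T : ℝ
  /-- length of a trading interval -/
  Δt : ℝ
  /-- number of trading intervals -/
  K : ℕ
  /-- regulation cycle -/
  Γ : ℝ
  /-- activation period -/
  γ : ℝ
  /-- regulation cycle of the smaller uncertainty set -/
  Γhat : ℝ
  /-- activation period of the smaller uncertainty set -/
  γhat : ℝ
  /-- charging efficiency -/
  ηplus : ℝ
  /-- discharging efficiency -/
  ηminus : ℝ
  /-- power consumption for driving -/
  d : Traj T
  /-- maximum charging power -/
  yplus : Traj T
  /-- maximum discharging power -/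
  yminus : Traj T
  /-- lower limit of the state-of-charge -/
  ylow : ℝ
  /-- upper limit of the state-of-charge -/
  yupp : ℝ
  /-- lower end of the interval of initial states used in the constraints -/
  y0low : ℝ
  /-- upper end of the interval of initial states used in the constraints -/
  y0upp : ℝ
  /-- lower end of the interval of initial states used in the objective -/
  y0lowHat : ℝ
  /-- upper end of the interval of initial states used in the objective -/
  y0uppHat : ℝ
  /-- target state-of-charge -/
  ystar : ℝ
  /-- penalty parameter -/
  pstar : ℝ
  /-- price of power bought from the utility -/
  pb : Traj T
  /-- expected regulation price -/
  pr : Traj T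
  /-- admissible bids -/
  X : Set (Traj T)

namespace Data

variable (P : Data)

/-- The trading interval of `k : Fin K` is `[k Δt, (k + 1) Δt)`; the last one also contains its
right end point `T`, so that the trading intervals partition `[0, T]`. -/
def tradingInterval (k : Fin P.K) : Set ℝ :=
  {t | ((k : ℕ) : ℝ) * P.Δt ≤ t ∧
    (t < (((k : ℕ) : ℝ) + 1) * P.Δt ∨ ((k : ℕ) + 1 = P.K ∧ t = (((k : ℕ) : ℝ) + 1) * P.Δt))}

/-- The lifting operator `L`: the piecewise constant function with values `v`. -/
def lift (v : Fin P.K → ℝ) : Traj P.T :=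
  fun t => ∑ k, (P.tradingInterval k).indicator (fun _ => v k) (t : ℝ)

/-- The adjoint operator `L†`: averages over the trading intervals. -/
def average (w : Traj P.T) : Fin P.K → ℝ :=
  fun k => (1 / P.Δt) *
    ∫ s in (((k : ℕ) : ℝ) * P.Δt)..((((k : ℕ) : ℝ) + 1) * P.Δt), extendZero w s

/-- The uncertainty set of the constraints. -/
def D : Set (Traj P.T) := deviationSet P.T P.Γ P.γ

/-- The uncertainty set of the objective. -/
def Dhat : Set (Traj P.T) := deviationSet P.T P.Γhat P.γhat

/-- The discretized uncertainty set of the constraints. -/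
def DK : Set (Fin P.K → ℝ) := deviationSetK P.K P.Δt P.Γ P.γ

/-- The discretized uncertainty set of the objective. -/
def DhatK : Set (Fin P.K → ℝ) := deviationSetK P.K P.Δt P.Γhat P.γhat

/-- Initial states-of-charge considered in the constraints. -/
def Y0 : Set ℝ := Icc P.y0low P.y0upp

/-- Initial states-of-charge considered in the objective. -/
def Y0hat : Set ℝ := Icc P.y0lowHat P.y0uppHat

/-- Battery state-of-charge at time `t`. -/
def soc (xb xr δ : Traj P.T) (y₀ t : ℝ) : ℝ :=
  y₀ + ∫ s in (0 : ℝ)..t,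
    extendZero (fun τ => P.ηplus * chargeRate (xb τ) (xr τ) (δ τ)
      - dischargeRate (xb τ) (xr τ) (δ τ) / P.ηminus - P.d τ) s

/-- Expected cost. -/
def cost (xb xr : Traj P.T) : ℝ :=
  ∫ s in (0 : ℝ)..P.T, extendZero (fun τ => P.pb τ * xb τ - P.pr τ * xr τ) s

/-- The penalties for missing the target state-of-charge over all scenarios. -/
def penalties (xb xr : Traj P.T) : Set ℝ :=
  {z | ∃ δ ∈ P.Dhat, ∃ y₀ ∈ P.Y0hat, z = P.pstar * |P.soc xb xr δ y₀ P.T - P.ystar|}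

/-- Objective function of the continuous-time problem. -/
def objective (x : Traj P.T × Traj P.T) : ℝ := P.cost x.1 x.2 + sSup (P.penalties x.1 x.2)

/-- Feasible set of the continuous-time problem. -/
def feasible : Set (Traj P.T × Traj P.T) :=
  {x | x.1 ∈ P.X ∧ x.2 ∈ P.X ∧
    (∀ δ ∈ P.D, ∀ t, chargeRate (x.1 t) (x.2 t) (δ t) ≤ P.yplus t) ∧
    (∀ δ ∈ P.D, ∀ t, dischargeRate (x.1 t) (x.2 t) (δ t) ≤ P.yminus t) ∧
    (∀ δ ∈ P.D, ∀ t : Icc (0 : ℝ) P.T, ∀ y₀ ∈ P.Y0, P.soc x.1 x.2 δ y₀ t ≤ P.yupp) ∧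
    (∀ δ ∈ P.D, ∀ t : Icc (0 : ℝ) P.T, ∀ y₀ ∈ P.Y0, P.ylow ≤ P.soc x.1 x.2 δ y₀ t)}

/-- Optimal value of the continuous-time problem (`⊤` if it is infeasible, `⊥` if unbounded). -/
def optValue : EReal := ⨅ x ∈ P.feasible, (P.objective x : EReal)

/-- Optimal solutions of the continuous-time problem. -/
def solutions : Set (Traj P.T × Traj P.T) :=
  {x | x ∈ P.feasible ∧ ∀ x' ∈ P.feasible, P.objective x ≤ P.objective x'}

/-- Admissible bid vectors. -/
def XK : Set (Fin P.K → ℝ) := P.average '' P.X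

/-- State-of-charge at the end of period `k`, for `k = 0, …, K` (at time `0` if `k = 0`), where
`dK` is the vector of power demands. -/
def socK (dK : Fin P.K → ℝ) (xb xr δ : Fin P.K → ℝ) (y₀ : ℝ) (k : ℕ) : ℝ :=
  y₀ + P.Δt * ∑ l ∈ Finset.univ.filter (fun l : Fin P.K => (l : ℕ) < k),
    (P.ηplus * chargeRate (xb l) (xr l) (δ l)
      - 1 / P.ηminus * dischargeRate (xb l) (xr l) (δ l) - dK l)

/-- Expected cost of bid vectors. -/
def costK (xb xr : Fin P.K → ℝ) : ℝ := P.cost (P.lift xb) (P.lift xr)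

/-- The penalties for missing the target state-of-charge over all discretized scenarios. -/
def penaltiesK (dK : Fin P.K → ℝ) (xb xr : Fin P.K → ℝ) : Set ℝ :=
  {z | ∃ δ ∈ P.DhatK, ∃ y₀ ∈ P.Y0hat, z = P.pstar * |P.socK dK xb xr δ y₀ P.K - P.ystar|}

/-- Objective function of the discrete-time problem. -/
def objectiveK (dK : Fin P.K → ℝ) (x : (Fin P.K → ℝ) × (Fin P.K → ℝ)) : ℝ :=
  P.costK x.1 x.2 + sSup (P.penaltiesK dK x.1 x.2)

/-- Feasible set of the discrete-time problem, where `dK`, `yplusK`, `yminusK` are the vectors of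
power demands and of maximum charging and discharging powers. -/
def feasibleK (dK yplusK yminusK : Fin P.K → ℝ) : Set ((Fin P.K → ℝ) × (Fin P.K → ℝ)) :=
  {x | x.1 ∈ P.XK ∧ x.2 ∈ P.XK ∧
    (∀ δ ∈ P.DK, ∀ k, chargeRate (x.1 k) (x.2 k) (δ k) ≤ yplusK k) ∧
    (∀ δ ∈ P.DK, ∀ k, dischargeRate (x.1 k) (x.2 k) (δ k) ≤ yminusK k) ∧
    (∀ δ ∈ P.DK, ∀ k ≤ P.K, ∀ y₀ ∈ P.Y0, P.socK dK x.1 x.2 δ y₀ k ≤ P.yupp) ∧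
    (∀ δ ∈ P.DK, ∀ k ≤ P.K, ∀ y₀ ∈ P.Y0, P.ylow ≤ P.socK dK x.1 x.2 δ y₀ k)}

/-- Optimal value of the discrete-time problem. -/
def optValueK (dK yplusK yminusK : Fin P.K → ℝ) : EReal :=
  ⨅ x ∈ P.feasibleK dK yplusK yminusK, (P.objectiveK dK x : EReal)

/-- Optimal solutions of the discrete-time problem. -/
def solutionsK (dK yplusK yminusK : Fin P.K → ℝ) : Set ((Fin P.K → ℝ) × (Fin P.K → ℝ)) :=
  {x | x ∈ P.feasibleK dK yplusK yminusK ∧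
    ∀ x' ∈ P.feasibleK dK yplusK yminusK, P.objectiveK dK x ≤ P.objectiveK dK x'}

/-- The pair of lifted bids. -/
def liftPair (x : (Fin P.K → ℝ) × (Fin P.K → ℝ)) : Traj P.T × Traj P.T :=
  (P.lift x.1, P.lift x.2)

/-- The standing assumptions of the model. -/
structure Standing : Prop where
  Δt_pos : 0 < P.Δt
  horizon : P.T = P.K * P.Δt
  γ_pos : 0 < P.γ
  γ_le : P.γ ≤ P.Γ
  Γ_le : P.Γ ≤ P.T
  Γhat_ge : P.Γ ≤ P.Γhat
  γhat_le : P.γhat ≤ P.γ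
  ηplus_mem : P.ηplus ∈ Ioc (0 : ℝ) 1
  ηminus_mem : P.ηminus ∈ Ioc (0 : ℝ) 1
  d_nonneg : ∀ t, 0 ≤ P.d t
  /-- the vehicle is not connected to a charger while it is driving -/
  driving : ∀ t, 0 < P.d t → P.yplus t = 0 ∧ P.yminus t = 0
  Y0hat_nonempty : P.y0lowHat ≤ P.y0uppHat
  pstar_nonneg : 0 ≤ P.pstar
  pb_integrable : IntervalIntegrable (extendZero P.pb) volume 0 P.T
  pr_integrable : IntervalIntegrable (extendZero P.pr) volume 0 P.T
  X_sub : P.X ⊆ riemannClass P.T (Ici 0)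

/-- The data are piecewise constant, with values `dK`, `yplusK`, `yminusK`, and so are all
admissible bids. -/
structure PiecewiseConstant (dK yplusK yminusK : Fin P.K → ℝ) : Prop where
  d_eq : P.d = P.lift dK
  yplus_eq : P.yplus = P.lift yplusK
  yminus_eq : P.yminus = P.lift yminusK
  bids : ∀ x ∈ P.X, ∃ v : Fin P.K → ℝ, x = P.lift v

/-- The regulation cycles and activation periods are positive multiples of `Δt`. -/
structure Divisible : Prop where
  Γ_mul : ∃ n : ℕ, 0 < n ∧ P.Γ = n * P.Δt
  γ_mul : ∃ n : ℕ, 0 < n ∧ P.γ = n * P.Δt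
  Γhat_mul : ∃ n : ℕ, 0 < n ∧ P.Γhat = n * P.Δt
  γhat_mul : ∃ n : ℕ, 0 < n ∧ P.γhat = n * P.Δt

end Data

end VehicleToGrid

end

open Set MeasureTheory

noncomputable section

namespace VehicleToGrid

/-! Two facts connect the problems: lifting a discrete scenario gives a continuous one
(`lift_mem_deviationSet`), and every continuous state-of-charge is bracketed by discrete ones.

With nonnegative bids, the storage rate is a concave, nondecreasing function of the deviation,
because conversion losses penalize discharging. For the upper bound, replacing a trajectory by the
averages of its absolute value over the trading intervals keeps it admissible (`absAverage_window`)
and can only raise the state-of-charge at grid times (`soc_grid_le_socK`).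

For the lower bound, averaging fails: the mean of a concave function may lie below its value at the
mean. Instead, the rate is bounded below by its chord between the deviations 0 and -1, which is
linear in the absolute deviation (`le_storageRate`). A linear functional over the polytope of window
constraints is minimized at a zero-one vector (`exists_zero_one_rounding`); this needs integer
bounds, hence divisibility of the activation period. At deviations 0 and -1 the chord is exact, so
the rounded vector is a discrete scenario that does at least as badly (`exists_socK_add_le`).

Between grid times, either the vehicle is parked, and an end point of the interval is at least as
critical, or it drives, and then the power limits force the bids to vanish
(`bids_eq_zero_of_driving`) and the state-of-charge only falls (`soc_le_socK`,
`exists_socK_le_soc`). The penalty is a convex function of the terminal state-of-charge, so the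
bracketing also gives equality of the worst-case penalties (`isGreatest_penalties_lift`). -/

/-- The sum of the first `j` entries of a vector. -/
def prefixSum {K : ℕ} (v : Fin K → ℝ) (j : ℕ) : ℝ :=
  ∑ l ∈ Finset.univ.filter (fun l : Fin K => (l : ℕ) < j), v l

/-! ### Prefix sums and the discretized uncertainty set -/

section PrefixSum

variable {K : ℕ}

@[simp]
lemma prefixSum_zero (v : Fin K → ℝ) : prefixSum v 0 = 0 := by simp [prefixSum]

lemma prefixSum_succ (v : Fin K → ℝ) (k : Fin K) :
    prefixSum v (k + 1) = prefixSum v k + v k := by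
  have h : Finset.univ.filter (fun l : Fin K => (l : ℕ) < (k : ℕ) + 1)
      = insert k (Finset.univ.filter (fun l : Fin K => (l : ℕ) < (k : ℕ))) := by
    ext l
    simp only [Finset.mem_filter, Finset.mem_univ, true_and, Finset.mem_insert, Fin.ext_iff]
    omega
  rw [prefixSum, h, Finset.sum_insert (by simp), prefixSum, add_comm]

lemma prefixSum_window (v : Fin K → ℝ) {i j : ℕ} (hij : i ≤ j) :
    prefixSum v j - prefixSum v i
      = ∑ l ∈ Finset.univ.filter (fun l : Fin K => i ≤ (l : ℕ) ∧ (l : ℕ) < j), v l := by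
  rw [sub_eq_iff_eq_add, prefixSum, prefixSum, ← Finset.sum_union]
  · refine Finset.sum_congr ?_ fun _ _ => rfl
    ext l
    simp only [Finset.mem_filter, Finset.mem_univ, true_and, Finset.mem_union]
    omega
  · rw [Finset.disjoint_filter]
    intro l _ h1 h2
    omega

lemma prefixSum_mono {v : Fin K → ℝ} (hv : ∀ k, 0 ≤ v k) {i j : ℕ} (hij : i ≤ j) :
    prefixSum v i ≤ prefixSum v j := by
  have := prefixSum_window v hij
  have h2 : 0 ≤ ∑ l ∈ Finset.univ.filter (fun l : Fin K => i ≤ (l : ℕ) ∧ (l : ℕ) < j), v l :=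
    Finset.sum_nonneg fun _ _ => hv _
  linarith

/-- Membership in the discretized uncertainty set in terms of prefix sums, when the regulation
cycle and the activation period are multiples of `Δt`. -/
lemma mem_deviationSetK_iff {Δt : ℝ} (hΔ : 0 < Δt) (n m : ℕ) (δ : Fin K → ℝ) :
    δ ∈ deviationSetK K Δt (n * Δt) (m * Δt) ↔
      (∀ k, |δ k| ≤ 1) ∧ ∀ j ≤ K,
        prefixSum (fun l => |δ l|) j - prefixSum (fun l => |δ l|) (j - n) ≤ m := by
  have hbox : (∀ k, δ k ∈ Icc (-1 : ℝ) 1) ↔ ∀ k, |δ k| ≤ 1 := by simp [abs_le]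
  -- Natural subtraction truncates at zero, so `k + 1 - n` encodes the positive part in the lower
  -- summation limit.
  have hsum : ∀ k : Fin K, ∑ l ∈ Finset.univ.filter (fun l : Fin K =>
        1 + max (((k : ℕ) : ℝ) + 1 - n * Δt / Δt) 0 ≤ ((l : ℕ) : ℝ) + 1 ∧ l ≤ k), |δ l|
      = prefixSum (fun l => |δ l|) (k + 1) - prefixSum (fun l => |δ l|) (k + 1 - n) := by
    intro k
    rw [prefixSum_window _ (Nat.sub_le _ _)]
    refine Finset.sum_congr ?_ fun _ _ => rfl
    ext l
    simp only [Finset.mem_filter, Finset.mem_univ, true_and]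
    rw [mul_div_cancel_right₀ _ hΔ.ne', add_comm (1 : ℝ), add_le_add_iff_right, max_le_iff,
      Fin.le_def, sub_le_iff_le_add]
    refine and_congr ?_ (by omega)
    have h0 : (0 : ℝ) ≤ ((l : ℕ) : ℝ) := by positivity
    simp only [h0, and_true]
    rw [← Nat.cast_succ, ← Nat.cast_add, Nat.cast_le]
    omega
  rw [deviationSetK, mem_ofPred_eq, hbox]
  refine and_congr_right fun _ => ?_
  refine Iff.trans (forall_congr' fun k => by
    rw [hsum k, mul_div_cancel_right₀ (m : ℝ) hΔ.ne']) ?_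
  constructor
  · rintro h (_ | j) hj
    · simp
    · exact h ⟨j, hj⟩
  · exact fun h k => h (k + 1) k.2

lemma deviationSetK_of_forall_abs_eq {Δt : ℝ} (hΔ : 0 < Δt) {n m : ℕ} {a δ : Fin K → ℝ}
    (ha : ∀ k, |δ k| = a k) (h1 : ∀ k, a k ≤ 1)
    (h2 : ∀ j ≤ K, prefixSum a j - prefixSum a (j - n) ≤ m) :
    δ ∈ deviationSetK K Δt (n * Δt) (m * Δt) := by
  rw [mem_deviationSetK_iff hΔ]
  simpa only [ha] using And.intro h1 h2

/-- Since the activation period lasts at least one trading interval, a single interval may carry any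
deviation in `[-1, 1]`. The power limits, which involve one interval at a time, therefore see the
whole of `[-1, 1]`. -/
lemma single_mem_deviationSetK {Δt : ℝ} (hΔ : 0 < Δt) {n m : ℕ} (hm : 0 < m) (k : Fin K) {z : ℝ}
    (hz : |z| ≤ 1) : Pi.single k z ∈ deviationSetK K Δt (n * Δt) (m * Δt) := by
  refine deviationSetK_of_forall_abs_eq hΔ (a := Pi.single k |z|) ?_ ?_ ?_
  · intro l
    by_cases h : l = k
    · subst h; simp
    · simp [h]
  · intro l
    by_cases h : l = k
    · subst h; simpa
    · simp [h]
  · intro j _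
    rw [prefixSum_window _ (Nat.sub_le _ _)]
    have h0 : ∀ l, (0 : ℝ) ≤ (Pi.single k |z| : Fin K → ℝ) l := by
      intro l
      by_cases h : l = k
      · subst h; simp
      · simp [h]
    calc _ ≤ ∑ l, (Pi.single k |z| : Fin K → ℝ) l :=
          Finset.sum_le_sum_of_subset_of_nonneg (Finset.filter_subset _ _) fun _ _ _ => h0 _
      _ = |z| := by simp
      _ ≤ 1 := hz
      _ ≤ m := by exact_mod_cast hm

lemma zero_mem_deviationSetK {Δt : ℝ} (hΔ : 0 < Δt) (n m : ℕ) :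
    (0 : Fin K → ℝ) ∈ deviationSetK K Δt (n * Δt) (m * Δt) := by
  rw [mem_deviationSetK_iff hΔ]
  simp [prefixSum]

lemma isCompact_deviationSetK (Δt Γ γ : ℝ) : IsCompact (deviationSetK K Δt Γ γ) := by
  have hbox : IsCompact (Set.pi univ fun _ : Fin K => Icc (-1 : ℝ) 1) :=
    isCompact_univ_pi fun _ => isCompact_Icc
  have heq : deviationSetK K Δt Γ γ = (Set.pi univ fun _ : Fin K => Icc (-1 : ℝ) 1) ∩
      ⋂ k : Fin K, {δ | ∑ l ∈ Finset.univ.filter (fun l : Fin K =>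
        1 + max (((k : ℕ) : ℝ) + 1 - Γ / Δt) 0 ≤ ((l : ℕ) : ℝ) + 1 ∧ l ≤ k), |δ l| ≤ γ / Δt} := by
    ext δ
    simp only [deviationSetK, mem_ofPred_eq, mem_inter_iff, Set.mem_pi, mem_univ, true_imp_iff,
      mem_iInter]
  rw [heq]
  refine hbox.inter_right (isClosed_iInter fun k => isClosed_le ?_ continuous_const)
  fun_prop

end PrefixSum

/-! ### Integrality of the window polytope by randomized rounding -/

section Rounding

lemma intervalIntegrable_floor_add (x a b : ℝ) :
    IntervalIntegrable (fun θ : ℝ => (⌊x + θ⌋ : ℝ)) volume a b := by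
  refine Monotone.intervalIntegrable fun s t h => ?_
  exact_mod_cast Int.floor_mono (by linarith)

/-- Rounding down with a uniformly random shift is unbiased: the fractional part has mean `1 / 2`
over a period, which cancels the mean `1 / 2` of the shift. -/
lemma integral_floor_add (x : ℝ) : ∫ θ in (0 : ℝ)..1, (⌊x + θ⌋ : ℝ) = x := by
  have hfr : ∫ θ in (0 : ℝ)..1, Int.fract (x + θ) = 1 / 2 := by
    have hper : Function.Periodic (Int.fract : ℝ → ℝ) 1 := fun s => Int.fract_add_one s
    rw [intervalIntegral.integral_comp_add_left (fun θ => Int.fract θ), add_zero,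
      hper.intervalIntegral_add_eq x 0, zero_add,
      intervalIntegral.integral_congr_Ioo_of_le zero_le_one (g := fun s => s)]
    · simp
    · intro s hs
      exact Int.fract_eq_self.2 ⟨hs.1.le, hs.2⟩
  have hfl := intervalIntegrable_floor_add x 0 1
  have hlin : IntervalIntegrable (fun θ : ℝ => x + θ) volume 0 1 :=
    (by fun_prop : Continuous fun θ : ℝ => x + θ).intervalIntegrable _ _
  have h1 : ∫ θ in (0 : ℝ)..1, ((x + θ) - (⌊x + θ⌋ : ℝ)) = 1 / 2 := by
    simpa only [Int.self_sub_floor] using hfr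
  rw [intervalIntegral.integral_sub hlin hfl] at h1
  have h2 : ∫ θ in (0 : ℝ)..1, (x + θ) = x + 1 / 2 := by
    rw [intervalIntegral.integral_add (by simp) (by simp)]
    simp
  linarith

/-- Integrality of the polytope of vectors in the unit cube whose sums over windows of length `n`
are at most `m`: a linear functional is minimized by a zero-one vector. -/
lemma exists_zero_one_rounding {K n m : ℕ} {a : Fin K → ℝ} (h0 : ∀ k, 0 ≤ a k)
    (h1 : ∀ k, a k ≤ 1) (hw : ∀ j ≤ K, prefixSum a j - prefixSum a (j - n) ≤ m)
    (c : Fin K → ℝ) :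
    ∃ b : Fin K → ℝ, (∀ k, b k = 0 ∨ b k = 1) ∧
      (∀ j ≤ K, prefixSum b j - prefixSum b (j - n) ≤ m) ∧
      ∑ k, c k * b k ≤ ∑ k, c k * a k := by
  set A : ℕ → ℝ := prefixSum a
  have hA : ∀ k : Fin K, A (k + 1) = A k + a k := prefixSum_succ a
  -- All prefix sums are rounded with one common shift `θ`, and `b θ` consists of the increments.
  -- Each increment is 0 or 1 because the prefix sums grow by at most 1, and the window bounds
  -- survive because `m` is an integer.
  let b : ℝ → Fin K → ℝ := fun θ k => (⌊A (k + 1) + θ⌋ : ℝ) - ⌊A k + θ⌋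
  have hb : ∀ θ k, b θ k = 0 ∨ b θ k = 1 := by
    intro θ k
    have e1 : ⌊A k + θ⌋ ≤ ⌊A (k + 1) + θ⌋ := Int.floor_mono (by rw [hA]; linarith [h0 k])
    have e2 : ⌊A (k + 1) + θ⌋ ≤ ⌊A k + θ⌋ + 1 := by
      rw [← Int.floor_add_one]
      exact Int.floor_mono (by rw [hA]; linarith [h1 k])
    have e3 : ⌊A (k + 1) + θ⌋ = ⌊A k + θ⌋ ∨ ⌊A (k + 1) + θ⌋ = ⌊A k + θ⌋ + 1 := by omega
    rcases e3 with e | e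
    · left; simp [b, e]
    · right; simp [b, e]
  have hpre : ∀ θ, ∀ j ≤ K, prefixSum (b θ) j = (⌊A j + θ⌋ : ℝ) - ⌊A 0 + θ⌋ := by
    intro θ j
    induction j with
    | zero => simp
    | succ j ih =>
      intro hj
      rw [prefixSum_succ (b θ) ⟨j, hj⟩, ih (by omega)]
      simp only [b]
      ring
  have hwin : ∀ θ, ∀ j ≤ K, prefixSum (b θ) j - prefixSum (b θ) (j - n) ≤ m := by
    intro θ j hj
    rw [hpre θ j hj, hpre θ (j - n) (by omega)]
    have : ⌊A j + θ⌋ ≤ ⌊A (j - n) + θ⌋ + (m : ℤ) := by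
      rw [← Int.floor_add_natCast]
      exact Int.floor_mono (by linarith [hw j hj])
    have : (⌊A j + θ⌋ : ℝ) ≤ ⌊A (j - n) + θ⌋ + (m : ℝ) := by exact_mod_cast this
    linarith
  have hint : ∀ k, IntervalIntegrable (fun θ => c k * b θ k) volume 0 1 := fun k =>
    ((intervalIntegrable_floor_add _ _ _).sub (intervalIntegrable_floor_add _ _ _)).const_mul _
  have hval : ∫ θ in (0 : ℝ)..1, ∑ k, c k * b θ k = ∑ k, c k * a k := by
    rw [intervalIntegral.integral_finsetSum fun k _ => hint k]
    refine Finset.sum_congr rfl fun k _ => ?_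
    rw [intervalIntegral.integral_const_mul,
      intervalIntegral.integral_sub (intervalIntegrable_floor_add _ _ _)
        (intervalIntegrable_floor_add _ _ _), integral_floor_add, integral_floor_add, hA]
    ring
  -- The objective of `b θ`, averaged over the shift, is that of `a`; some shift does no worse than
  -- the average.
  have hex : ∃ θ : ℝ, ∑ k, c k * b θ k ≤ ∑ k, c k * a k := by
    by_contra! hcon
    have hI : IntervalIntegrable (fun θ => ∑ k, c k * b θ k) volume 0 1 := by
      refine (IntervalIntegrable.sum Finset.univ fun k _ => hint k).congr fun θ _ => ?_
      simp only [Finset.sum_apply]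
    have := intervalIntegral.intervalIntegral_pos_of_pos
      (f := fun θ => ∑ k, c k * b θ k - ∑ k, c k * a k) (hI.sub (by simp))
      (fun θ => sub_pos.2 (hcon θ)) zero_lt_one
    rw [intervalIntegral.integral_sub hI (by simp), hval] at this
    simp at this
  obtain ⟨θ, hθ⟩ := hex
  exact ⟨b θ, hb θ, hwin θ, hθ⟩

end Rounding

/-! ### Lebesgue integrability of Riemann integrable functions -/

section Riemann

lemma extendZero_apply {T : ℝ} (f : Traj T) {s : ℝ} (hs : s ∈ Icc (0 : ℝ) T) :
    extendZero f s = f ⟨s, hs⟩ :=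
  Subtype.val_injective.extend_apply f 0 ⟨s, hs⟩

/-- Taking gaps `2⁻ⁿ` makes the sum of `u n - l n` integrable, hence finite almost everywhere. The
gaps then tend to zero and `f` is the almost everywhere limit of the measurable `u n`. -/
lemma aestronglyMeasurable_of_squeeze {α : Type*} [MeasurableSpace α] {μ : Measure α} {f : α → ℝ}
    (h : ∀ ε : ℝ, 0 < ε → ∃ l u : α → ℝ, Integrable l μ ∧ Integrable u μ ∧ l ≤ᵐ[μ] f ∧
      f ≤ᵐ[μ] u ∧ ∫ x, (u x - l x) ∂μ < ε) : AEStronglyMeasurable f μ := by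
  choose l u hl hu hlf hfu hε using fun n : ℕ => h ((1 / 2) ^ n) (by positivity)
  have hdiff : ∀ n, ∫⁻ x, ENNReal.ofReal (u n x - l n x) ∂μ ≤ ENNReal.ofReal ((1 / 2) ^ n) := by
    intro n
    rw [← ofReal_integral_eq_lintegral_ofReal (f := fun x => u n x - l n x) ((hu n).sub (hl n))]
    · exact ENNReal.ofReal_le_ofReal (hε n).le
    · filter_upwards [hlf n, hfu n] with x h1 h2
      simpa using h1.trans h2
  have hmeas : ∀ n, AEMeasurable (fun x => ENNReal.ofReal (u n x - l n x)) μ := fun n =>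
    ((hu n).sub (hl n)).aestronglyMeasurable.aemeasurable.ennreal_ofReal
  have hfin : ∫⁻ x, ∑' n, ENNReal.ofReal (u n x - l n x) ∂μ ≠ ⊤ := by
    rw [lintegral_tsum hmeas]
    refine ne_top_of_le_ne_top ?_ (ENNReal.tsum_le_tsum hdiff)
    rw [← ENNReal.ofReal_tsum_of_nonneg (fun n => by positivity) summable_geometric_two]
    exact ENNReal.ofReal_ne_top
  refine aestronglyMeasurable_of_tendsto_ae Filter.atTop
    (fun n => (hu n).aestronglyMeasurable) ?_
  filter_upwards [ae_lt_top' (AEMeasurable.tsum hmeas) hfin, ae_all_iff.2 hlf,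
    ae_all_iff.2 hfu] with x hx h1 h2
  have hz := ENNReal.tendsto_atTop_zero_of_tsum_ne_top hx.ne
  have hz' : Filter.Tendsto (fun n => u n x - l n x) Filter.atTop (nhds 0) := by
    have := (ENNReal.tendsto_toReal ENNReal.zero_ne_top).comp hz
    simp only [ENNReal.toReal_zero] at this
    refine this.congr fun n => ?_
    exact ENNReal.toReal_ofReal (sub_nonneg.2 ((h1 n).trans (h2 n)))
  have hsq : Filter.Tendsto (fun n => u n x - f x) Filter.atTop (nhds 0) :=
    squeeze_zero (fun n => sub_nonneg.2 (h2 n)) (fun n => by linarith [h1 n]) hz'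
  simpa using hsq.add_const (f x)

/-- The function with value `m i` on the cell `(p i, p (i + 1)]`, for `i < n`. -/
def cellStep (n : ℕ) (p m : ℕ → ℝ) (s : ℝ) : ℝ :=
  ∑ i ∈ Finset.range n, (Ioc (p i) (p (i + 1))).indicator (fun _ => m i) s

lemma integrable_cellStep (n : ℕ) (p m : ℕ → ℝ) {μ : Measure ℝ} [IsFiniteMeasure μ] :
    Integrable (cellStep n p m) μ :=
  integrable_finsetSum _ fun _ _ => (integrable_const _).indicator measurableSet_Ioc

lemma cellStep_apply {n : ℕ} {p : ℕ → ℝ} (hp : Monotone p) (m : ℕ → ℝ) {i : ℕ} (hi : i < n)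
    {s : ℝ} (hs : s ∈ Ioc (p i) (p (i + 1))) : cellStep n p m s = m i := by
  rw [cellStep, Finset.sum_eq_single_of_mem i (Finset.mem_range.2 hi), indicator_of_mem hs]
  intro j _ hji
  exact indicator_of_notMem
    (fun hj => disjoint_left.1 (hp.pairwise_disjoint_on_Ioc_succ hji) hj hs) _

lemma RiemannIntegrable.aestronglyMeasurable {T : ℝ} {f : Traj T} (hf : RiemannIntegrable f) :
    AEStronglyMeasurable (extendZero f) (volume.restrict (Ioc 0 T)) := by
  refine aestronglyMeasurable_of_squeeze fun ε hε => ?_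
  obtain ⟨n, q, m, M, hq0, hqn, hqm, hb, hsum⟩ := hf ε hε
  -- The partition is frozen after index `n`, which makes it monotone on all of `ℕ` without changing
  -- its first `n` cells.
  set p : ℕ → ℝ := fun i => q (min i n) with hpdef
  have hpq : ∀ i < n, p i = q i ∧ p (i + 1) = q (i + 1) := by
    intro i hi
    simp only [hpdef]
    rw [min_eq_left hi.le, min_eq_left (by omega)]
    exact ⟨rfl, rfl⟩
  have hp : Monotone p := by
    refine monotone_nat_of_le_succ fun i => ?_
    rcases lt_or_ge i n with hi | hi
    · rw [(hpq i hi).1, (hpq i hi).2]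
      exact hqm i hi
    · simp only [hpdef]
      rw [min_eq_right hi, min_eq_right (by omega)]
  have hp0 : p 0 = 0 := by simp [hpdef, hq0]
  have hpn : p n = T := by simp [hpdef, hqn]
  have hcell : ∀ s ∈ Ioc (0 : ℝ) T, ∃ i < n, s ∈ Ioc (p i) (p (i + 1)) := by
    intro s hs
    rw [← hp0, ← hpn, ← hp.biUnion_Ico_Ioc_map_succ 0 n] at hs
    simp only [mem_iUnion, mem_Ico] at hs
    obtain ⟨i, hi, hsi⟩ := hs
    exact ⟨i, hi.2, hsi⟩
  have hbound : ∀ s ∈ Ioc (0 : ℝ) T,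
      cellStep n p m s ≤ extendZero f s ∧ extendZero f s ≤ cellStep n p M s := by
    intro s hs
    obtain ⟨i, hi, hsi⟩ := hcell s hs
    rw [cellStep_apply hp m hi hsi, cellStep_apply hp M hi hsi,
      extendZero_apply f (Ioc_subset_Icc_self hs)]
    rw [(hpq i hi).1, (hpq i hi).2] at hsi
    exact hb i hi _ hsi.1.le hsi.2
  refine ⟨cellStep n p m, cellStep n p M, integrable_cellStep _ _ _, integrable_cellStep _ _ _,
    ?_, ?_, ?_⟩
  · filter_upwards [ae_restrict_mem measurableSet_Ioc] with s hs using (hbound s hs).1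
  · filter_upwards [ae_restrict_mem measurableSet_Ioc] with s hs using (hbound s hs).2
  · refine lt_of_eq_of_lt ?_ hsum
    have hfun : ∀ s, cellStep n p M s - cellStep n p m s
        = ∑ i ∈ Finset.range n, (Ioc (p i) (p (i + 1))).indicator (fun _ => M i - m i) s := by
      intro s
      rw [cellStep, cellStep, ← Finset.sum_sub_distrib]
      refine Finset.sum_congr rfl fun i _ => ?_
      by_cases h : s ∈ Ioc (p i) (p (i + 1)) <;> simp [h]
    simp only [hfun]
    rw [integral_finsetSum _ fun i _ => (integrable_const _).indicator measurableSet_Ioc]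
    refine Finset.sum_congr rfl fun i hi => ?_
    have hi := Finset.mem_range.1 hi
    have hsub : Ioc (p i) (p (i + 1)) ⊆ Ioc 0 T := by
      rw [← hp0, ← hpn]
      exact Ioc_subset_Ioc (hp (Nat.zero_le _)) (hp hi)
    rw [integral_indicator measurableSet_Ioc, Measure.restrict_restrict measurableSet_Ioc,
      inter_eq_left.2 hsub, integral_const]
    simp only [measureReal_restrict_apply_univ, smul_eq_mul]
    rw [Real.volume_real_Ioc_of_le (hp (Nat.le_succ i)), (hpq i hi).1, (hpq i hi).2, mul_comm]

lemma intervalIntegrable_of_mem_riemannClass {T : ℝ} (hT : 0 ≤ T) {f : Traj T}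
    (hf : f ∈ riemannClass T (Icc (-1) 1)) :
    IntervalIntegrable (extendZero f) volume 0 T := by
  rw [intervalIntegrable_iff_integrableOn_Ioc_of_le hT]
  refine ⟨hf.2.aestronglyMeasurable, HasFiniteIntegral.restrict_of_bounded 1
    measure_Ioc_lt_top ?_⟩
  · filter_upwards [ae_restrict_mem measurableSet_Ioc] with s hs
    rw [extendZero_apply f (Ioc_subset_Icc_self hs), Real.norm_eq_abs]
    exact abs_le.2 (hf.1 _)

end Riemann

/-! ### Concavity bounds for the storage rate -/

section Rate

/-- The rate of change of the state-of-charge of a parked vehicle. -/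
def storageRate (ηp ηm xb xr z : ℝ) : ℝ :=
  ηp * chargeRate xb xr z - dischargeRate xb xr z / ηm

variable {ηp ηm xb xr : ℝ}

/-- This form exposes the concavity: a linear term minus a convex function weighted by the
round-trip loss, which is nonnegative by `loss_nonneg`. -/
lemma storageRate_eq (z : ℝ) : storageRate ηp ηm xb xr z
    = ηp * (xb + z * xr) - (1 / ηm - ηp) * max (-(xb + z * xr)) 0 := by
  have h := max_zero_sub_max_neg_zero_eq_self (xb + z * xr)
  rw [storageRate, chargeRate, dischargeRate, eq_add_of_sub_eq h]
  ring

lemma loss_nonneg (hp : ηp ∈ Ioc (0 : ℝ) 1) (hm : ηm ∈ Ioc (0 : ℝ) 1) : 0 ≤ 1 / ηm - ηp := by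
  have : 1 ≤ 1 / ηm := one_le_one_div hm.1 hm.2
  linarith [hp.2]

/-- Dropping the loss and the sign of the deviation leaves a bound that is linear in `|z|`; it is
attained for nonnegative `z` and bids, by `storageRate_of_nonneg`. -/
lemma storageRate_le (hp : ηp ∈ Ioc (0 : ℝ) 1) (hm : ηm ∈ Ioc (0 : ℝ) 1) (hr : 0 ≤ xr) (z : ℝ) :
    storageRate ηp ηm xb xr z ≤ ηp * (xb + |z| * xr) := by
  rw [storageRate_eq]
  have h1 : 0 ≤ (1 / ηm - ηp) * max (-(xb + z * xr)) 0 :=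
    mul_nonneg (loss_nonneg hp hm) (le_max_right _ _)
  have h2 : ηp * (xb + z * xr) ≤ ηp * (xb + |z| * xr) := by
    gcongr
    · exact hp.1.le
    · exact le_abs_self z
  linarith

lemma storageRate_of_nonneg (hb : 0 ≤ xb) (hr : 0 ≤ xr) {z : ℝ} (hz : 0 ≤ z) :
    storageRate ηp ηm xb xr z = ηp * (xb + z * xr) := by
  rw [storageRate_eq, max_eq_right]
  · ring
  · have := mul_nonneg hz hr
    linarith

/-- The left-hand side is the chord between the deviations 0 and -1, evaluated at `-|z|`. Concavity
puts the rate at `-|z|` above it, and monotonicity passes from `-|z|` to `z`. -/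
lemma le_storageRate (hp : ηp ∈ Ioc (0 : ℝ) 1) (hm : ηm ∈ Ioc (0 : ℝ) 1) (hb : 0 ≤ xb)
    (hr : 0 ≤ xr) {z : ℝ} (hz : |z| ≤ 1) :
    ηp * xb + |z| * (storageRate ηp ηm xb xr (-1) - ηp * xb) ≤ storageRate ηp ηm xb xr z := by
  rw [storageRate_eq, storageRate_eq]
  have hw := abs_nonneg z
  have hzr : -(|z| * xr) ≤ z * xr := by
    rw [← neg_mul]
    exact mul_le_mul_of_nonneg_right (neg_abs_le z) hr
  have h1 : ηp * (xb - |z| * xr) ≤ ηp * (xb + z * xr) :=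
    mul_le_mul_of_nonneg_left (by linarith) hp.1.le
  have h2 : max (-(xb + z * xr)) 0 ≤ |z| * max (-(xb + -1 * xr)) 0 := by
    refine max_le ?_ (mul_nonneg hw (le_max_right _ _))
    have h3 : |z| * (-(xb + -1 * xr)) ≤ |z| * max (-(xb + -1 * xr)) 0 :=
      mul_le_mul_of_nonneg_left (le_max_left _ _) hw
    have h4 : |z| * xb ≤ xb := mul_le_of_le_one_left hb hz
    linarith
  have h5 := mul_le_mul_of_nonneg_left h2 (loss_nonneg hp hm)
  linarith

variable {D : ℝ → ℝ} {a b : ℝ}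

lemma intervalIntegrable_storageRate (hD : IntervalIntegrable D volume a b) (ηp ηm xb xr : ℝ) :
    IntervalIntegrable (fun s => storageRate ηp ηm xb xr (D s)) volume a b := by
  simp only [storageRate_eq]
  have h1 : IntervalIntegrable (fun s => xb + D s * xr) volume a b :=
    intervalIntegrable_const.add (hD.mul_const xr)
  have h2 : IntervalIntegrable (fun s => max (-(xb + D s * xr)) 0) volume a b :=
    ⟨h1.neg.1.pos_part, h1.neg.2.pos_part⟩
  exact (h1.const_mul _).sub (h2.const_mul _)

lemma integral_storageRate_le (hp : ηp ∈ Ioc (0 : ℝ) 1) (hm : ηm ∈ Ioc (0 : ℝ) 1) (hr : 0 ≤ xr)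
    (hab : a ≤ b) (hD : IntervalIntegrable D volume a b) :
    ∫ s in a..b, storageRate ηp ηm xb xr (D s)
      ≤ ηp * (xb * (b - a) + (∫ s in a..b, |D s|) * xr) := by
  have hi : IntervalIntegrable (fun s => ηp * (xb + |D s| * xr)) volume a b :=
    (intervalIntegrable_const.add (hD.abs.mul_const xr)).const_mul ηp
  refine (intervalIntegral.integral_mono_on hab (intervalIntegrable_storageRate hD _ _ _ _) hi
    fun s _ => storageRate_le hp hm hr _).trans_eq ?_
  rw [intervalIntegral.integral_const_mul,
    intervalIntegral.integral_add intervalIntegrable_const (hD.abs.mul_const xr),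
    intervalIntegral.integral_mul_const, intervalIntegral.integral_const, smul_eq_mul,
    mul_comm xb]

lemma le_integral_storageRate (hp : ηp ∈ Ioc (0 : ℝ) 1) (hm : ηm ∈ Ioc (0 : ℝ) 1) (hb : 0 ≤ xb)
    (hr : 0 ≤ xr) (hab : a ≤ b) (hD : IntervalIntegrable D volume a b)
    (h1 : ∀ s ∈ Icc a b, |D s| ≤ 1) :
    ηp * xb * (b - a) + (∫ s in a..b, |D s|) * (storageRate ηp ηm xb xr (-1) - ηp * xb)
      ≤ ∫ s in a..b, storageRate ηp ηm xb xr (D s) := by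
  have hi : IntervalIntegrable (fun s => ηp * xb
      + |D s| * (storageRate ηp ηm xb xr (-1) - ηp * xb)) volume a b :=
    intervalIntegrable_const.add (hD.abs.mul_const _)
  refine Eq.trans_le ?_ (intervalIntegral.integral_mono_on hab hi
    (intervalIntegrable_storageRate hD _ _ _ _) fun s hs => le_storageRate hp hm hb hr (h1 s hs))
  rw [intervalIntegral.integral_add intervalIntegrable_const (hD.abs.mul_const _),
    intervalIntegral.integral_const, intervalIntegral.integral_mul_const, smul_eq_mul,
    mul_comm (b - a)]

end Rate

namespace Data

variable {P : Data}

/-! ### Trading intervals, lifting and averaging -/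

section Grid

lemma tradingInterval_subset (k : Fin P.K) :
    P.tradingInterval k ⊆ Icc (((k : ℕ) : ℝ) * P.Δt) ((((k : ℕ) : ℝ) + 1) * P.Δt) := by
  rintro t ⟨h1, h2 | ⟨-, h2⟩⟩
  exacts [⟨h1, h2.le⟩, ⟨h1, h2.le⟩]

lemma Ico_subset_tradingInterval (k : Fin P.K) :
    Ico (((k : ℕ) : ℝ) * P.Δt) ((((k : ℕ) : ℝ) + 1) * P.Δt) ⊆ P.tradingInterval k :=
  fun _ ht => ⟨ht.1, Or.inl ht.2⟩

lemma intervalIntegrable_of_cells (hT : P.T = P.K * P.Δt) {F : ℝ → ℝ}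
    (hF : ∀ k : Fin P.K, IntervalIntegrable F volume
      (((k : ℕ) : ℝ) * P.Δt) ((((k : ℕ) : ℝ) + 1) * P.Δt)) :
    IntervalIntegrable F volume 0 P.T := by
  have h := IntervalIntegrable.trans_iterate (f := F) (μ := volume) (n := P.K)
    (a := fun j : ℕ => (j : ℝ) * P.Δt) fun j hj => by
      push_cast
      exact hF ⟨j, hj⟩
  simpa [hT] using h

variable (hΔ : 0 < P.Δt) (hT : P.T = P.K * P.Δt)
include hΔ

lemma not_mem_tradingInterval_of_lt {j k : Fin P.K} (hjk : j < k) {t : ℝ}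
    (ht : t ∈ P.tradingInterval k) : t ∉ P.tradingInterval j := by
  rintro ⟨-, h⟩
  have hjk' : (j : ℕ) + 1 ≤ k := hjk
  have h1 : (((j : ℕ) : ℝ) + 1) * P.Δt ≤ t := by
    refine le_trans ?_ ht.1
    gcongr
    exact_mod_cast hjk'
  rcases h with h | ⟨h, -⟩
  · exact absurd h h1.not_gt
  · have := k.2
    omega

lemma lift_apply (v : Fin P.K → ℝ) {k : Fin P.K} {t : Icc (0 : ℝ) P.T}
    (ht : (t : ℝ) ∈ P.tradingInterval k) : P.lift v t = v k := by
  rw [lift, Finset.sum_eq_single_of_mem k (Finset.mem_univ k), indicator_of_mem ht]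
  intro j _ hjk
  refine indicator_of_notMem ?_ _
  rcases lt_or_gt_of_ne hjk with h | h
  · exact not_mem_tradingInterval_of_lt hΔ h ht
  · exact fun h' => not_mem_tradingInterval_of_lt hΔ h h' ht

include hT

lemma grid_le_horizon {j : ℕ} (hj : j ≤ P.K) : (j : ℝ) * P.Δt ≤ P.T := by
  rw [hT]
  gcongr

lemma grid_succ_le_horizon (k : Fin P.K) : (((k : ℕ) : ℝ) + 1) * P.Δt ≤ P.T := by
  have := grid_le_horizon hΔ hT (Nat.succ_le_of_lt k.2)
  push_cast at this
  exact this

lemma cell_subset_horizon (k : Fin P.K) :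
    Icc (((k : ℕ) : ℝ) * P.Δt) ((((k : ℕ) : ℝ) + 1) * P.Δt) ⊆ Icc 0 P.T :=
  Icc_subset_Icc (by positivity) (grid_succ_le_horizon hΔ hT k)

lemma exists_mem_tradingInterval (hK : 0 < P.K) {t : ℝ} (ht : t ∈ Icc (0 : ℝ) P.T) :
    ∃ k : Fin P.K, t ∈ P.tradingInterval k := by
  rcases ht.2.lt_or_eq with h | h
  · have h0 : 0 ≤ t / P.Δt := div_nonneg ht.1 hΔ.le
    have hlt : ⌊t / P.Δt⌋₊ < P.K := by
      rw [Nat.floor_lt h0, div_lt_iff₀ hΔ, ← hT]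
      exact h
    refine ⟨⟨⌊t / P.Δt⌋₊, hlt⟩, ?_, Or.inl ?_⟩
    · rw [← le_div_iff₀ hΔ]
      exact Nat.floor_le h0
    · rw [← div_lt_iff₀ hΔ]
      exact Nat.lt_floor_add_one _
  · refine ⟨⟨P.K - 1, by omega⟩, ?_⟩
    have hc : ((P.K - 1 : ℕ) : ℝ) + 1 = P.K := by
      exact_mod_cast Nat.sub_add_cancel hK
    have ht' : t = (((P.K - 1 : ℕ) : ℝ) + 1) * P.Δt := by rw [hc, ← hT, h]
    refine ⟨?_, Or.inr ⟨by simp only; omega, ht'⟩⟩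
    rw [ht']
    gcongr
    linarith

lemma exists_mem_cell (hK : 0 < P.K) {t : ℝ} (ht : t ∈ Icc (0 : ℝ) P.T) :
    ∃ k : Fin P.K, t ∈ Icc (((k : ℕ) : ℝ) * P.Δt) ((((k : ℕ) : ℝ) + 1) * P.Δt) :=
  (exists_mem_tradingInterval hΔ hT hK ht).imp fun k h => tradingInterval_subset k h

lemma extendZero_lift (v : Fin P.K → ℝ) {k : Fin P.K} {s : ℝ}
    (hs : s ∈ Ico (((k : ℕ) : ℝ) * P.Δt) ((((k : ℕ) : ℝ) + 1) * P.Δt)) :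
    extendZero (P.lift v) s = v k := by
  rw [extendZero_apply _ (cell_subset_horizon hΔ hT k (Ico_subset_Icc_self hs))]
  exact lift_apply hΔ v (Ico_subset_tradingInterval k hs)

lemma exists_lift_apply_eq (k : Fin P.K) : ∃ t : Icc (0 : ℝ) P.T, ∀ v, P.lift v t = v k := by
  have hs : ((k : ℕ) : ℝ) * P.Δt ∈ Ico (((k : ℕ) : ℝ) * P.Δt) ((((k : ℕ) : ℝ) + 1) * P.Δt) :=
    ⟨le_rfl, by gcongr; linarith⟩
  exact ⟨⟨_, cell_subset_horizon hΔ hT k (Ico_subset_Icc_self hs)⟩,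
    fun v => lift_apply hΔ v (Ico_subset_tradingInterval k hs)⟩

lemma average_lift (v : Fin P.K → ℝ) : P.average (P.lift v) = v := by
  funext k
  rw [average, intervalIntegral.integral_congr_Ioo_of_le (g := fun _ => v k)
    (by gcongr; linarith) (fun s hs => extendZero_lift hΔ hT v (Ioo_subset_Ico_self hs))]
  rw [intervalIntegral.integral_const, smul_eq_mul]
  field_simp
  ring

lemma lift_injective : Function.Injective P.lift :=
  Function.LeftInverse.injective (average_lift hΔ hT)

lemma intervalIntegrable_cell {F : ℝ → ℝ} (hF : IntervalIntegrable F volume 0 P.T)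
    {k : Fin P.K} {u v : ℝ} (hu : ((k : ℕ) : ℝ) * P.Δt ≤ u) (huv : u ≤ v)
    (hv : v ≤ (((k : ℕ) : ℝ) + 1) * P.Δt) : IntervalIntegrable F volume u v := by
  have h1 : (0 : ℝ) ≤ ((k : ℕ) : ℝ) * P.Δt := by positivity
  have h2 := grid_succ_le_horizon hΔ hT k
  refine hF.mono_set ?_
  rw [uIcc_of_le huv, uIcc_of_le (by linarith)]
  exact Icc_subset_Icc (h1.trans hu) (hv.trans h2)

lemma integral_grid {F : ℝ → ℝ} (hF : IntervalIntegrable F volume 0 P.T) {j : ℕ}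
    (hj : j ≤ P.K) :
    ∫ s in (0 : ℝ)..(j : ℝ) * P.Δt, F s = prefixSum (fun k : Fin P.K =>
      ∫ s in (((k : ℕ) : ℝ) * P.Δt)..((((k : ℕ) : ℝ) + 1) * P.Δt), F s) j := by
  induction j with
  | zero => simp
  | succ j ih =>
    have hle : ((j : ℕ) : ℝ) * P.Δt ≤ (((j : ℕ) : ℝ) + 1) * P.Δt := by gcongr; linarith
    have hjT := grid_le_horizon hΔ hT (Nat.le_of_succ_le hj)
    have h1 : IntervalIntegrable F volume 0 ((j : ℝ) * P.Δt) := by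
      refine hF.mono_set ?_
      rw [uIcc_of_le (by positivity), uIcc_of_le (by rw [hT]; positivity)]
      exact Icc_subset_Icc le_rfl hjT
    have h2 := intervalIntegrable_cell hΔ hT hF (k := ⟨j, hj⟩) le_rfl hle le_rfl
    rw [prefixSum_succ _ ⟨j, hj⟩, ← ih (by omega)]
    push_cast
    exact (intervalIntegral.integral_add_adjacent_intervals h1 h2).symm

lemma integral_mem_cell {F : ℝ → ℝ} (hF : IntervalIntegrable F volume 0 P.T) {k : Fin P.K}
    {t : ℝ} (ht : t ∈ Icc (((k : ℕ) : ℝ) * P.Δt) ((((k : ℕ) : ℝ) + 1) * P.Δt)) :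
    ∫ s in (0 : ℝ)..t, F s = (∫ s in (0 : ℝ)..((k : ℕ) : ℝ) * P.Δt, F s)
      + ∫ s in (((k : ℕ) : ℝ) * P.Δt)..t, F s := by
  refine (intervalIntegral.integral_add_adjacent_intervals ?_
    (intervalIntegrable_cell hΔ hT hF le_rfl ht.1 ht.2)).symm
  refine hF.mono_set ?_
  rw [uIcc_of_le (by positivity), uIcc_of_le (by rw [hT]; positivity)]
  exact Icc_subset_Icc le_rfl (grid_le_horizon hΔ hT k.2.le)

/-- The Darboux bounds are required on closed cells, but a lifted vector may jump at the right end
of a trading interval. Each interval is therefore cut into a long cell on which the function is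
constant and a short cell of length `e` with the crude bounds -1 and 1. -/
lemma lift_mem_riemannClass {v : Fin P.K → ℝ} (hK : 0 < P.K) (hv : ∀ k, |v k| ≤ 1) :
    P.lift v ∈ riemannClass P.T (Icc (-1) 1) := by
  have hbound : ∀ t, -1 ≤ P.lift v t ∧ P.lift v t ≤ 1 := by
    intro t
    obtain ⟨k, hk⟩ := exists_mem_tradingInterval hΔ hT hK t.2
    rw [lift_apply hΔ v hk]
    exact abs_le.1 (hv k)
  refine ⟨hbound, fun ε hε => ?_⟩
  -- There are `2 * P.K` cells, each contributing at most `2 * e`.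
  obtain ⟨e, he0, heΔ, heε⟩ : ∃ e, 0 < e ∧ e ≤ P.Δt ∧ 4 * P.K * e < ε := by
    have hK' : (0 : ℝ) < P.K := by exact_mod_cast hK
    refine ⟨min P.Δt (ε / (8 * P.K)), by positivity, min_le_left _ _, ?_⟩
    calc 4 * (P.K : ℝ) * min P.Δt (ε / (8 * P.K)) ≤ 4 * P.K * (ε / (8 * P.K)) := by
          gcongr
          exact min_le_right _ _
      _ = ε / 2 := by field_simp; ring
      _ < ε := by linarith
  -- Even indices are starts of trading intervals, odd indices are the cuts at distance `e` before
  -- their ends.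
  let p : ℕ → ℝ := fun i => ((i / 2 : ℕ) : ℝ) * P.Δt + if i % 2 = 0 then 0 else P.Δt - e
  let val : ℕ → ℝ := fun i => if h : i / 2 < P.K then v ⟨i / 2, h⟩ else 0
  let m : ℕ → ℝ := fun i => if i % 2 = 0 then val i else -1
  let M : ℕ → ℝ := fun i => if i % 2 = 0 then val i else 1
  have heven : ∀ i, i % 2 = 0 → p (i + 1) = p i + (P.Δt - e) := by
    intro i hi
    have h1 : (i + 1) / 2 = i / 2 := by omega
    have h2 : (i + 1) % 2 ≠ 0 := by omega
    simp [p, hi, h1, h2]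
  have hodd : ∀ i, i % 2 ≠ 0 → p (i + 1) = p i + e := by
    intro i hi
    have h1 : (i + 1) / 2 = i / 2 + 1 := by omega
    have h2 : (i + 1) % 2 = 0 := by omega
    simp only [p, hi, h1, h2, if_true, if_false]
    push_cast
    ring
  refine ⟨2 * P.K, p, m, M, by simp [p], ?_, ?_, ?_, ?_⟩
  · simp [p, hT]
  · intro i _
    by_cases hi : i % 2 = 0
    · rw [heven i hi]; linarith
    · rw [hodd i hi]; linarith
  · intro i hi t h1 h2
    by_cases hi2 : i % 2 = 0
    · have hlt : i / 2 < P.K := by omega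
      rw [heven i hi2] at h2
      have hp : p i = ((i / 2 : ℕ) : ℝ) * P.Δt := by simp [p, hi2]
      rw [hp] at h1 h2
      have : P.lift v t = v ⟨i / 2, hlt⟩ :=
        lift_apply hΔ v (Ico_subset_tradingInterval _ ⟨h1, by simp only; linarith⟩)
      simp [m, M, val, hi2, hlt, this]
    · simpa [m, M, hi2] using hbound t
  · refine lt_of_le_of_lt (Finset.sum_le_sum (g := fun _ => 2 * e) fun i _ => ?_) ?_
    · by_cases hi : i % 2 = 0
      · simp [m, M, hi, he0.le]
      · rw [hodd i hi]
        simp only [m, M, hi, if_false]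
        linarith
    · simp only [Finset.sum_const, Finset.card_range, nsmul_eq_mul]
      push_cast
      linarith

end Grid

/-! ### Passing between continuous and discrete scenarios -/

section Scenarios

variable (hΔ : 0 < P.Δt) (hT : P.T = P.K * P.Δt)
include hΔ hT

lemma integral_abs_lift {v : Fin P.K → ℝ} {k : Fin P.K} {u t : ℝ}
    (hu : ((k : ℕ) : ℝ) * P.Δt ≤ u) (hut : u ≤ t) (ht : t ≤ (((k : ℕ) : ℝ) + 1) * P.Δt) :
    ∫ s in u..t, |extendZero (P.lift v) s| = (t - u) * |v k| := by
  rw [intervalIntegral.integral_congr_Ioo_of_le (g := fun _ => |v k|) hut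
    (fun s hs => congrArg _ (extendZero_lift hΔ hT v ⟨hu.trans hs.1.le, hs.2.trans_le ht⟩)),
    intervalIntegral.integral_const, smul_eq_mul]

/-- The accumulated absolute value of a piecewise constant function interpolates the prefix sums
linearly. -/
lemma integral_abs_lift_eq {v : Fin P.K → ℝ} (hv : ∀ k, |v k| ≤ 1) (k : Fin P.K) {τ : ℝ}
    (h0 : 0 ≤ τ) (h1 : τ ≤ 1) :
    ∫ s in (0 : ℝ)..(((k : ℕ) : ℝ) + τ) * P.Δt, |extendZero (P.lift v) s|
      = P.Δt * ((1 - τ) * prefixSum (fun l => |v l|) k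
        + τ * prefixSum (fun l => |v l|) (k + 1)) := by
  have hK : 0 < P.K := k.pos
  have hTn : 0 ≤ P.T := by rw [hT]; positivity
  have hI := (intervalIntegrable_of_mem_riemannClass hTn
    (lift_mem_riemannClass hΔ hT hK hv)).abs
  have hmem : (((k : ℕ) : ℝ) + τ) * P.Δt ∈
      Icc (((k : ℕ) : ℝ) * P.Δt) ((((k : ℕ) : ℝ) + 1) * P.Δt) :=
    ⟨by gcongr; linarith, by gcongr⟩
  rw [integral_mem_cell hΔ hT hI hmem, integral_grid hΔ hT hI k.2.le,
    integral_abs_lift hΔ hT le_rfl hmem.1 hmem.2, prefixSum_succ]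
  have hcell : ∀ l : Fin P.K, ∫ s in (((l : ℕ) : ℝ) * P.Δt)..((((l : ℕ) : ℝ) + 1) * P.Δt),
      |extendZero (P.lift v) s| = P.Δt * |v l| := by
    intro l
    rw [integral_abs_lift hΔ hT le_rfl (by gcongr; linarith) le_rfl]
    ring
  simp only [hcell]
  rw [prefixSum, prefixSum, ← Finset.mul_sum]
  ring

/-- Because the cycle is a multiple of `Δt`, both ends of a moving window sit at the same fraction
`τ` of their trading intervals. A window integral is then a convex combination of two consecutive
discrete window sums, each bounded by `m`. -/
lemma lift_mem_deviationSet (hK : 0 < P.K) {n m : ℕ} {β : Fin P.K → ℝ}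
    (hβ : β ∈ deviationSetK P.K P.Δt (n * P.Δt) (m * P.Δt)) :
    P.lift β ∈ deviationSet P.T (n * P.Δt) (m * P.Δt) := by
  rw [mem_deviationSetK_iff hΔ] at hβ
  obtain ⟨hβ1, hβw⟩ := hβ
  have hmem := lift_mem_riemannClass hΔ hT hK hβ1
  refine ⟨hmem, fun t => ?_⟩
  have hTn : 0 ≤ P.T := t.2.1.trans t.2.2
  have hI := (intervalIntegrable_of_mem_riemannClass hTn hmem).abs
  obtain ⟨k, hk⟩ := exists_mem_cell hΔ hT hK t.2
  obtain ⟨τ, h0, h1, ht⟩ : ∃ τ : ℝ, 0 ≤ τ ∧ τ ≤ 1 ∧ (t : ℝ) = (((k : ℕ) : ℝ) + τ) * P.Δt := by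
    refine ⟨(t : ℝ) / P.Δt - (k : ℕ), ?_, ?_, ?_⟩
    · rw [sub_nonneg, le_div_iff₀ hΔ]
      exact hk.1
    · rw [sub_le_iff_le_add, div_le_iff₀ hΔ, add_comm]
      exact hk.2
    · field_simp
      ring
  have hmono : prefixSum (fun l => |β l|) k ≤ prefixSum (fun l => |β l|) (k + 1) :=
    prefixSum_mono (fun _ => abs_nonneg _) (Nat.le_succ _)
  have hw1 := hβw (k + 1) k.2
  have hw0 := hβw k k.2.le
  have hIt := integral_abs_lift_eq hΔ hT hβ1 k h0 h1
  rw [mul_comm (m : ℝ)]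
  rcases Nat.lt_or_ge k n with hkn | hkn
  -- Here the window is truncated at time 0, and the full window ending with interval `k` already
  -- bounds the integral.
  · have hkn' : ((k : ℕ) : ℝ) + 1 ≤ n := by exact_mod_cast hkn
    have hle : (t : ℝ) - n * P.Δt ≤ 0 := by
      rw [ht, ← sub_mul]
      exact mul_nonpos_of_nonpos_of_nonneg (by linarith) hΔ.le
    rw [max_eq_right hle, ht, hIt]
    rw [Nat.sub_eq_zero_of_le (by omega), prefixSum_zero, sub_zero] at hw1
    gcongr
    have := mul_le_mul_of_nonneg_left hmono (sub_nonneg.2 h1)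
    linarith
  · let k' : Fin P.K := ⟨k - n, by omega⟩
    have hkk : ((k' : ℕ) : ℝ) = ((k : ℕ) : ℝ) - n := Nat.cast_sub hkn
    have hshift : (t : ℝ) - n * P.Δt = (((k' : ℕ) : ℝ) + τ) * P.Δt := by
      rw [ht, hkk]
      ring
    have hnn : 0 ≤ (t : ℝ) - n * P.Δt := by
      rw [hshift]
      positivity
    have hIs := integral_abs_lift_eq hΔ hT hβ1 k' h0 h1
    have hsub : ∀ u ∈ Icc (0 : ℝ) P.T,
        IntervalIntegrable (fun s => |extendZero (P.lift β) s|) volume 0 u := by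
      intro u hu
      refine hI.mono_set ?_
      rw [uIcc_of_le hu.1, uIcc_of_le hTn]
      exact Icc_subset_Icc le_rfl hu.2
    have hnΔ : 0 ≤ n * P.Δt := by positivity
    rw [max_eq_left hnn, ← intervalIntegral.integral_interval_sub_left (hsub _ t.2)
      (hsub _ ⟨hnn, by linarith [t.2.2]⟩), hshift, ht, hIt, hIs, ← mul_sub]
    have hk1 : (k : ℕ) + 1 - n = k' + 1 := by simp only [k']; omega
    rw [hk1] at hw1
    have e0 := mul_le_mul_of_nonneg_left hw0 (sub_nonneg.2 h1)
    have e1 := mul_le_mul_of_nonneg_left hw1 h0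
    gcongr
    linarith

/-- The averages of the absolute value of a function over the trading intervals. -/
def absAverage (P : Data) (D : ℝ → ℝ) (k : Fin P.K) : ℝ :=
  (1 / P.Δt) * ∫ s in (((k : ℕ) : ℝ) * P.Δt)..((((k : ℕ) : ℝ) + 1) * P.Δt), |D s|

omit hT in
lemma mul_absAverage (D : ℝ → ℝ) (k : Fin P.K) : P.Δt * P.absAverage D k
    = ∫ s in (((k : ℕ) : ℝ) * P.Δt)..((((k : ℕ) : ℝ) + 1) * P.Δt), |D s| := by
  rw [absAverage, ← mul_assoc, mul_one_div_cancel hΔ.ne', one_mul]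

omit hT in
lemma absAverage_nonneg (D : ℝ → ℝ) (k : Fin P.K) : 0 ≤ P.absAverage D k :=
  mul_nonneg (by positivity)
    (intervalIntegral.integral_nonneg (by gcongr; linarith) fun _ _ => abs_nonneg _)

omit hΔ hT in
lemma abs_extendZero_le_one {T : ℝ} {δ : Traj T} (hδ : δ ∈ riemannClass T (Icc (-1) 1)) {s : ℝ}
    (hs : s ∈ Icc 0 T) : |extendZero δ s| ≤ 1 := by
  rw [extendZero_apply δ hs]
  exact abs_le.2 (hδ.1 _)

lemma absAverage_le_one {δ : Traj P.T} (hδ : δ ∈ riemannClass P.T (Icc (-1) 1)) (k : Fin P.K) :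
    P.absAverage (extendZero δ) k ≤ 1 := by
  have hTn : 0 ≤ P.T := by rw [hT]; positivity
  have hle : ((k : ℕ) : ℝ) * P.Δt ≤ (((k : ℕ) : ℝ) + 1) * P.Δt := by gcongr; linarith
  have hI := intervalIntegrable_cell hΔ hT (intervalIntegrable_of_mem_riemannClass hTn hδ)
    (k := k) le_rfl hle le_rfl
  have h := intervalIntegral.integral_mono_on hle hI.abs intervalIntegrable_const
    fun s hs => abs_extendZero_le_one hδ (cell_subset_horizon hΔ hT k hs)
  rw [intervalIntegral.integral_const, smul_eq_mul, mul_one, ← mul_absAverage hΔ] at h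
  refine le_of_mul_le_mul_left (h.trans_eq ?_) hΔ
  ring

/-- Only the continuous constraints at grid times are needed; at `j * Δt` the window consists of
whole trading intervals. -/
lemma absAverage_window {n m : ℕ} {δ : Traj P.T}
    (hδ : δ ∈ deviationSet P.T (n * P.Δt) (m * P.Δt)) {j : ℕ} (hj : j ≤ P.K) :
    prefixSum (P.absAverage (extendZero δ)) j - prefixSum (P.absAverage (extendZero δ)) (j - n)
      ≤ m := by
  have hTn : 0 ≤ P.T := by rw [hT]; positivity
  have hI := (intervalIntegrable_of_mem_riemannClass hTn hδ.1).abs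
  have hpre : ∀ i ≤ P.K, P.Δt * prefixSum (P.absAverage (extendZero δ)) i
      = ∫ s in (0 : ℝ)..(i : ℝ) * P.Δt, |extendZero δ s| := by
    intro i hi
    rw [integral_grid hΔ hT hI hi, prefixSum, prefixSum, Finset.mul_sum]
    exact Finset.sum_congr rfl fun l _ => mul_absAverage hΔ _ l
  have hsub : ∀ i ≤ P.K,
      IntervalIntegrable (fun s => |extendZero δ s|) volume 0 ((i : ℝ) * P.Δt) := by
    intro i hi
    refine hI.mono_set ?_
    rw [uIcc_of_le (by positivity), uIcc_of_le hTn]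
    exact Icc_subset_Icc le_rfl (grid_le_horizon hΔ hT hi)
  have hmax : max ((j : ℝ) * P.Δt - n * P.Δt) 0 = ((j - n : ℕ) : ℝ) * P.Δt := by
    rcases le_total n j with h | h
    · rw [Nat.cast_sub h, sub_mul, max_eq_left]
      rw [← sub_mul]
      exact mul_nonneg (sub_nonneg.2 (by exact_mod_cast h)) hΔ.le
    · rw [Nat.sub_eq_zero_of_le h, max_eq_right]
      · simp
      · rw [← sub_mul]
        exact mul_nonpos_of_nonpos_of_nonneg (sub_nonpos.2 (by exact_mod_cast h)) hΔ.le
  have h := hδ.2 ⟨(j : ℝ) * P.Δt, by positivity, grid_le_horizon hΔ hT hj⟩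
  simp only at h
  rw [hmax, ← intervalIntegral.integral_interval_sub_left (hsub j hj) (hsub (j - n) (by omega)),
    ← hpre j hj, ← hpre (j - n) (by omega), ← mul_sub, mul_comm] at h
  exact le_of_mul_le_mul_right h hΔ

end Scenarios

/-! ### The state-of-charge for lifted bids -/

section StateOfCharge

lemma socK_eq (dK xb xr δ : Fin P.K → ℝ) (y₀ : ℝ) (j : ℕ) :
    P.socK dK xb xr δ y₀ j = y₀ + P.Δt * prefixSum (fun l =>
      storageRate P.ηplus P.ηminus (xb l) (xr l) (δ l) - dK l) j := by
  rw [socK, prefixSum]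
  refine congrArg (fun z => y₀ + P.Δt * z) (Finset.sum_congr rfl fun l _ => ?_)
  rw [storageRate]
  ring

variable {dK xb xr : Fin P.K → ℝ}
variable (hΔ : 0 < P.Δt) (hT : P.T = P.K * P.Δt) (hd : P.d = P.lift dK)
include hΔ hT hd

lemma integrand_apply (δ : Traj P.T) {k : Fin P.K} {s : ℝ}
    (hs : s ∈ Ico (((k : ℕ) : ℝ) * P.Δt) ((((k : ℕ) : ℝ) + 1) * P.Δt)) :
    extendZero (fun τ => P.ηplus * chargeRate (P.lift xb τ) (P.lift xr τ) (δ τ)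
      - dischargeRate (P.lift xb τ) (P.lift xr τ) (δ τ) / P.ηminus - P.d τ) s
      = storageRate P.ηplus P.ηminus (xb k) (xr k) (extendZero δ s) - dK k := by
  have hs' := cell_subset_horizon hΔ hT k (Ico_subset_Icc_self hs)
  have ht := Ico_subset_tradingInterval k hs
  rw [extendZero_apply _ hs', extendZero_apply _ hs', hd, storageRate,
    lift_apply hΔ xb (t := ⟨s, hs'⟩) ht, lift_apply hΔ xr (t := ⟨s, hs'⟩) ht,
    lift_apply hΔ dK (t := ⟨s, hs'⟩) ht]

variable {δ : Traj P.T} (hδ : IntervalIntegrable (extendZero δ) volume 0 P.T)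
include hδ

lemma integral_integrand {k : Fin P.K} {t : ℝ}
    (ht : t ∈ Icc (((k : ℕ) : ℝ) * P.Δt) ((((k : ℕ) : ℝ) + 1) * P.Δt)) :
    ∫ s in (((k : ℕ) : ℝ) * P.Δt)..t,
      extendZero (fun τ => P.ηplus * chargeRate (P.lift xb τ) (P.lift xr τ) (δ τ)
        - dischargeRate (P.lift xb τ) (P.lift xr τ) (δ τ) / P.ηminus - P.d τ) s
      = (∫ s in (((k : ℕ) : ℝ) * P.Δt)..t,
          storageRate P.ηplus P.ηminus (xb k) (xr k) (extendZero δ s))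
        - (t - ((k : ℕ) : ℝ) * P.Δt) * dK k := by
  rw [intervalIntegral.integral_congr_Ioo_of_le ht.1
      (fun s hs => integrand_apply hΔ hT hd δ ⟨hs.1.le, hs.2.trans_le ht.2⟩),
    intervalIntegral.integral_sub (intervalIntegrable_storageRate
      (intervalIntegrable_cell hΔ hT hδ le_rfl ht.1 ht.2) _ _ _ _) intervalIntegrable_const,
    intervalIntegral.integral_const, smul_eq_mul]

lemma intervalIntegrable_integrand : IntervalIntegrable
    (extendZero (fun τ => P.ηplus * chargeRate (P.lift xb τ) (P.lift xr τ) (δ τ)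
      - dischargeRate (P.lift xb τ) (P.lift xr τ) (δ τ) / P.ηminus - P.d τ)) volume 0 P.T := by
  refine intervalIntegrable_of_cells hT fun k => ?_
  have hle : ((k : ℕ) : ℝ) * P.Δt ≤ (((k : ℕ) : ℝ) + 1) * P.Δt := by gcongr; linarith
  refine ((intervalIntegrable_storageRate (intervalIntegrable_cell hΔ hT hδ (k := k) le_rfl hle
    le_rfl) P.ηplus P.ηminus (xb k) (xr k)).sub
    (intervalIntegrable_const (c := dK k))).congr_uIoo fun s hs => ?_
  rw [uIoo_of_le hle] at hs
  exact (integrand_apply hΔ hT hd δ (Ioo_subset_Ico_self hs)).symm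

lemma soc_grid (y₀ : ℝ) {j : ℕ} (hj : j ≤ P.K) :
    P.soc (P.lift xb) (P.lift xr) δ y₀ (j * P.Δt) = y₀ + prefixSum (fun k : Fin P.K =>
      (∫ s in (((k : ℕ) : ℝ) * P.Δt)..((((k : ℕ) : ℝ) + 1) * P.Δt),
        storageRate P.ηplus P.ηminus (xb k) (xr k) (extendZero δ s)) - P.Δt * dK k) j := by
  rw [soc, integral_grid hΔ hT (intervalIntegrable_integrand hΔ hT hd hδ) hj]
  refine congrArg (fun w => y₀ + prefixSum w j) (funext fun k => ?_)
  rw [integral_integrand hΔ hT hd hδ ⟨by gcongr; linarith, le_rfl⟩]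
  ring

lemma soc_mem_cell (y₀ : ℝ) {k : Fin P.K} {t : ℝ}
    (ht : t ∈ Icc (((k : ℕ) : ℝ) * P.Δt) ((((k : ℕ) : ℝ) + 1) * P.Δt)) :
    P.soc (P.lift xb) (P.lift xr) δ y₀ t
      = P.soc (P.lift xb) (P.lift xr) δ y₀ (((k : ℕ) : ℝ) * P.Δt)
        + ((∫ s in (((k : ℕ) : ℝ) * P.Δt)..t,
          storageRate P.ηplus P.ηminus (xb k) (xr k) (extendZero δ s))
        - (t - ((k : ℕ) : ℝ) * P.Δt) * dK k) := by
  rw [soc, soc, integral_mem_cell hΔ hT (intervalIntegrable_integrand hΔ hT hd hδ) ht,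
    integral_integrand hΔ hT hd hδ ht, add_assoc]

omit hδ in
lemma soc_lift_grid (hK : 0 < P.K) {β : Fin P.K → ℝ} (hβ : ∀ k, |β k| ≤ 1) (y₀ : ℝ) {j : ℕ}
    (hj : j ≤ P.K) : P.soc (P.lift xb) (P.lift xr) (P.lift β) y₀ (j * P.Δt)
      = P.socK dK xb xr β y₀ j := by
  have hI := intervalIntegrable_of_mem_riemannClass (by rw [hT]; positivity)
    (lift_mem_riemannClass hΔ hT hK hβ)
  rw [soc_grid hΔ hT hd hI y₀ hj, socK_eq, prefixSum, prefixSum, Finset.mul_sum]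
  refine congrArg _ (Finset.sum_congr rfl fun k _ => ?_)
  rw [intervalIntegral.integral_congr_Ioo_of_le
    (g := fun _ => storageRate P.ηplus P.ηminus (xb k) (xr k) (β k)) (by gcongr; linarith)
    (fun s hs => congrArg _ (extendZero_lift hΔ hT β (Ioo_subset_Ico_self hs))),
    intervalIntegral.integral_const, smul_eq_mul]
  ring

end StateOfCharge

end Data

@[simp]
lemma storageRate_zero_zero (ηp ηm z : ℝ) : storageRate ηp ηm 0 0 z = 0 := by
  simp [storageRate_eq]

namespace Data

variable {P : Data}

lemma Standing.horizon_nonneg (hS : P.Standing) : 0 ≤ P.T := by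
  linarith [hS.γ_pos, hS.γ_le, hS.Γ_le]

lemma Standing.K_pos (hS : P.Standing) : 0 < P.K := by
  rcases Nat.eq_zero_or_pos P.K with h | h
  · have := hS.horizon
    rw [h, Nat.cast_zero, zero_mul] at this
    linarith [hS.γ_pos, hS.γ_le, hS.Γ_le]
  · exact h

/-! ### Bracketing the state-of-charge by discrete scenarios -/

section Bounds

variable {dK xb xr : Fin P.K → ℝ} (hS : P.Standing) (hd : P.d = P.lift dK)
  (hb : ∀ k, 0 ≤ xb k) (hr : ∀ k, 0 ≤ xr k)
include hS hd hr

omit hr in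
lemma dK_nonneg (k : Fin P.K) : 0 ≤ dK k := by
  obtain ⟨t, ht⟩ := exists_lift_apply_eq hS.Δt_pos hS.horizon k
  rw [← ht dK, ← hd]
  exact hS.d_nonneg t

variable {n m : ℕ} {δ : Traj P.T} (hδ : δ ∈ deviationSet P.T (n * P.Δt) (m * P.Δt))
include hδ

omit hd hr in
lemma absAverage_mem_deviationSetK :
    P.absAverage (extendZero δ) ∈ deviationSetK P.K P.Δt (n * P.Δt) (m * P.Δt) :=
  deviationSetK_of_forall_abs_eq hS.Δt_pos
    (fun k => abs_of_nonneg (absAverage_nonneg hS.Δt_pos _ k))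
    (absAverage_le_one hS.Δt_pos hS.horizon hδ.1)
    (fun _ hj => absAverage_window hS.Δt_pos hS.horizon hδ hj)

omit hS hd hr in
lemma intervalIntegrable_deviation (hS : P.Standing) :
    IntervalIntegrable (extendZero δ) volume 0 P.T :=
  intervalIntegrable_of_mem_riemannClass hS.horizon_nonneg hδ.1

omit hd hr in
/-- Every linear functional of the average absolute deviations is bounded below by its value at
some deviations that are `0` or `-1` in every trading interval. -/
lemma exists_rounded_deviation (c : Fin P.K → ℝ) :
    ∃ β ∈ deviationSetK P.K P.Δt (n * P.Δt) (m * P.Δt), (∀ k, β k = 0 ∨ β k = -1) ∧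
      ∑ k, c k * |β k| ≤ ∑ k, c k * P.absAverage (extendZero δ) k := by
  obtain ⟨b, hb01, hbw, hbc⟩ := exists_zero_one_rounding
    (absAverage_nonneg hS.Δt_pos (extendZero δ))
    (absAverage_le_one hS.Δt_pos hS.horizon hδ.1)
    (fun _ hj => absAverage_window hS.Δt_pos hS.horizon hδ hj) c
  have habs : ∀ k, |(-b) k| = b k := fun k => by rcases hb01 k with h | h <;> simp [h]
  refine ⟨-b, deviationSetK_of_forall_abs_eq hS.Δt_pos habs
    (fun k => by rcases hb01 k with h | h <;> simp [h]) hbw,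
    fun k => by rcases hb01 k with h | h <;> simp [h], ?_⟩
  simpa only [habs] using hbc

include hb

/-- Averaging the absolute value of the deviations can only increase the state-of-charge. -/
lemma soc_grid_le_socK (y₀ : ℝ) {j : ℕ} (hj : j ≤ P.K) :
    P.soc (P.lift xb) (P.lift xr) δ y₀ (j * P.Δt)
      ≤ P.socK dK xb xr (P.absAverage (extendZero δ)) y₀ j := by
  have hΔ := hS.Δt_pos
  have hI := intervalIntegrable_deviation hδ hS
  rw [soc_grid hΔ hS.horizon hd hI y₀ hj, socK_eq, prefixSum, prefixSum, Finset.mul_sum]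
  gcongr with k _
  have hle : ((k : ℕ) : ℝ) * P.Δt ≤ (((k : ℕ) : ℝ) + 1) * P.Δt := by gcongr; linarith
  have h := integral_storageRate_le (xb := xb k) hS.ηplus_mem hS.ηminus_mem (hr k) hle
    (intervalIntegrable_cell hΔ hS.horizon hI (k := k) le_rfl hle le_rfl)
  rw [← mul_absAverage hΔ] at h
  rw [storageRate_of_nonneg (hb k) (hr k) (absAverage_nonneg hΔ _ k)]
  linarith

/-- While parked, the upper bound by charging at the absolute deviation grows with time, so the
right end of the interval dominates. While driving, the bids vanish and the state-of-charge falls,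
so the left end dominates. -/
lemma soc_le_socK (hdrive : ∀ k, dK k = 0 ∨ xb k = 0 ∧ xr k = 0) (y₀ : ℝ) {k : Fin P.K} {t : ℝ}
    (ht : t ∈ Icc (((k : ℕ) : ℝ) * P.Δt) ((((k : ℕ) : ℝ) + 1) * P.Δt)) :
    P.soc (P.lift xb) (P.lift xr) δ y₀ t
        ≤ P.socK dK xb xr (P.absAverage (extendZero δ)) y₀ k ∨
      P.soc (P.lift xb) (P.lift xr) δ y₀ t
        ≤ P.socK dK xb xr (P.absAverage (extendZero δ)) y₀ (k + 1) := by
  have hΔ := hS.Δt_pos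
  have hI := intervalIntegrable_deviation hδ hS
  have hgrid := soc_grid_le_socK hS hd hb hr hδ y₀ k.2.le
  have hlen : 0 ≤ t - ((k : ℕ) : ℝ) * P.Δt := sub_nonneg.2 ht.1
  rw [soc_mem_cell hΔ hS.horizon hd hI y₀ ht]
  rcases hdrive k with hk | ⟨hk1, hk2⟩
  · right
    rw [socK_eq, prefixSum_succ, mul_add, ← add_assoc, ← socK_eq, hk]
    have h := integral_storageRate_le (xb := xb k) hS.ηplus_mem hS.ηminus_mem (hr k) ht.1
      (intervalIntegrable_cell hΔ hS.horizon hI (k := k) le_rfl ht.1 ht.2)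
    have hmono : ∫ s in (((k : ℕ) : ℝ) * P.Δt)..t, |extendZero δ s|
        ≤ P.Δt * P.absAverage (extendZero δ) k := by
      rw [mul_absAverage hΔ]
      exact intervalIntegral.integral_mono_interval le_rfl ht.1 ht.2
        (Filter.Eventually.of_forall fun _ => abs_nonneg _)
        (intervalIntegrable_cell hΔ hS.horizon hI (k := k) le_rfl (ht.1.trans ht.2) le_rfl).abs
    have hxb : xb k * (t - ((k : ℕ) : ℝ) * P.Δt) ≤ xb k * P.Δt :=
      mul_le_mul_of_nonneg_left (by linarith [ht.2]) (hb k)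
    have h2 := mul_le_mul_of_nonneg_left
      (add_le_add hxb (mul_le_mul_of_nonneg_right hmono (hr k))) hS.ηplus_mem.1.le
    rw [storageRate_of_nonneg (hb k) (hr k) (absAverage_nonneg hΔ _ k)]
    linarith
  · left
    have := mul_nonneg hlen (dK_nonneg hS hd k)
    simp only [hk1, hk2, storageRate_zero_zero, intervalIntegral.integral_zero]
    linarith

/-- Concavity bounds the state-of-charge from below by a linear function of the average absolute
deviations. -/
lemma linear_le_soc_grid (y₀ : ℝ) {j : ℕ} (hj : j ≤ P.K) :
    y₀ + P.Δt * prefixSum (fun k => P.ηplus * xb k - dK k + P.absAverage (extendZero δ) k *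
      (storageRate P.ηplus P.ηminus (xb k) (xr k) (-1) - P.ηplus * xb k)) j
      ≤ P.soc (P.lift xb) (P.lift xr) δ y₀ (j * P.Δt) := by
  have hΔ := hS.Δt_pos
  have hI := intervalIntegrable_deviation hδ hS
  rw [soc_grid hΔ hS.horizon hd hI y₀ hj, prefixSum, prefixSum, Finset.mul_sum]
  gcongr with k _
  have hle : ((k : ℕ) : ℝ) * P.Δt ≤ (((k : ℕ) : ℝ) + 1) * P.Δt := by gcongr; linarith
  have h := le_integral_storageRate hS.ηplus_mem hS.ηminus_mem (hb k) (hr k) hle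
    (intervalIntegrable_cell hΔ hS.horizon hI (k := k) le_rfl hle le_rfl)
    (fun s hs => abs_extendZero_le_one hδ.1 (cell_subset_horizon hΔ hS.horizon k hs))
  rw [← mul_absAverage hΔ] at h
  linarith

omit hS hd hr hδ hb in
-- The concave rate touches its chord at the end points 0 and -1, so the linear lower bound is exact
-- at rounded deviations.
lemma socK_of_zero_or_neg_one (hb : ∀ k, 0 ≤ xb k) (hr : ∀ k, 0 ≤ xr k) {β : Fin P.K → ℝ}
    (hβ : ∀ k, β k = 0 ∨ β k = -1) (y₀ : ℝ) (j : ℕ) :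
    P.socK dK xb xr β y₀ j = y₀ + P.Δt * prefixSum (fun k => P.ηplus * xb k - dK k + |β k| *
      (storageRate P.ηplus P.ηminus (xb k) (xr k) (-1) - P.ηplus * xb k)) j := by
  rw [socK_eq]
  refine congrArg (fun w => y₀ + P.Δt * prefixSum w j) (funext fun k => ?_)
  rcases hβ k with h | h
  · rw [h, storageRate_of_nonneg (hb k) (hr k) le_rfl]
    simp
  · rw [h]
    simp only [abs_neg, abs_one]
    ring

/-- A linear functional of the absolute deviations of the first `j` trading intervals and of one
more trading interval is bounded below by the rounded deviations. -/
lemma exists_socK_add_le (y₀ : ℝ) {j : ℕ} (hj : j ≤ P.K) (e : Fin P.K → ℝ) :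
    ∃ β ∈ deviationSetK P.K P.Δt (n * P.Δt) (m * P.Δt), (∀ k, β k = 0 ∨ β k = -1) ∧
      P.socK dK xb xr β y₀ j + P.Δt * ∑ k, e k * |β k|
        ≤ P.soc (P.lift xb) (P.lift xr) δ y₀ (j * P.Δt)
          + P.Δt * ∑ k, e k * P.absAverage (extendZero δ) k := by
  have hΔ := hS.Δt_pos
  set r : Fin P.K → ℝ := fun k =>
    storageRate P.ηplus P.ηminus (xb k) (xr k) (-1) - P.ηplus * xb k with hr_def
  -- The first `j` coefficients are the slopes of the chords; `e` leaves room for a partially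
  -- elapsed interval.
  obtain ⟨β, hβ, hβ01, hle⟩ := exists_rounded_deviation hS hδ
    (fun k => (if (k : ℕ) < j then r k else 0) + e k)
  refine ⟨β, hβ, hβ01, ?_⟩
  have hlin := linear_le_soc_grid hS hd hb hr hδ y₀ hj
  rw [socK_of_zero_or_neg_one hb hr hβ01]
  have hsplit : ∀ w : Fin P.K → ℝ,
      prefixSum (fun k => P.ηplus * xb k - dK k + w k * r k) j + ∑ k, e k * w k
        = prefixSum (fun k => P.ηplus * xb k - dK k) j
          + ∑ k : Fin P.K, ((if (k : ℕ) < j then r k else 0) + e k) * w k := by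
    intro w
    simp only [add_mul, Finset.sum_add_distrib, ite_mul, zero_mul]
    rw [prefixSum, prefixSum, Finset.sum_add_distrib, ← Finset.sum_filter, add_assoc]
    simp only [mul_comm (r _) (w _)]
  have h1 := hsplit (fun k => |β k|)
  have h2 := hsplit (P.absAverage (extendZero δ))
  have h3 : P.Δt * (prefixSum (fun k => P.ηplus * xb k - dK k + |β k| * r k) j
      + ∑ k, e k * |β k|) ≤ P.Δt * (prefixSum (fun k => P.ηplus * xb k - dK k
        + P.absAverage (extendZero δ) k * r k) j
      + ∑ k, e k * P.absAverage (extendZero δ) k) := by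
    rw [h1, h2]
    gcongr
  linarith

lemma exists_socK_le_soc_grid (y₀ : ℝ) {j : ℕ} (hj : j ≤ P.K) :
    ∃ β ∈ deviationSetK P.K P.Δt (n * P.Δt) (m * P.Δt),
      P.socK dK xb xr β y₀ j ≤ P.soc (P.lift xb) (P.lift xr) δ y₀ (j * P.Δt) := by
  obtain ⟨β, hβ, -, h⟩ := exists_socK_add_le hS hd hb hr hδ y₀ hj 0
  exact ⟨β, hβ, by simpa using h⟩

/-- Rounding cannot be applied to a part of an interval. While parked, the change over the part is
bounded below by a linear term in the average over the whole interval, and this term is rounded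
jointly with the past. -/
lemma exists_socK_le_soc (hdrive : ∀ k, dK k = 0 ∨ xb k = 0 ∧ xr k = 0) (y₀ : ℝ) {k : Fin P.K}
    {t : ℝ} (ht : t ∈ Icc (((k : ℕ) : ℝ) * P.Δt) ((((k : ℕ) : ℝ) + 1) * P.Δt)) :
    ∃ β ∈ deviationSetK P.K P.Δt (n * P.Δt) (m * P.Δt),
      P.socK dK xb xr β y₀ k ≤ P.soc (P.lift xb) (P.lift xr) δ y₀ t ∨
      P.socK dK xb xr β y₀ (k + 1) ≤ P.soc (P.lift xb) (P.lift xr) δ y₀ t := by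
  have hΔ := hS.Δt_pos
  have hI := intervalIntegrable_deviation hδ hS
  have hlen : 0 ≤ t - ((k : ℕ) : ℝ) * P.Δt := sub_nonneg.2 ht.1
  rw [soc_mem_cell hΔ hS.horizon hd hI y₀ ht]
  rcases hdrive k with hk | ⟨hk1, hk2⟩
  -- The truncation `min r 0` is the slope that remains valid for a partial interval: if discharging
  -- dominates, the full interval is worst; otherwise stopping at its start is worst.
  · set r := storageRate P.ηplus P.ηminus (xb k) (xr k) (-1) with hr_def
    obtain ⟨β, hβ, hβ01, hle⟩ := exists_socK_add_le hS hd hb hr hδ y₀ k.2.le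
      (Pi.single k (min r 0))
    have hsingle : ∀ w : Fin P.K → ℝ,
        ∑ l, (Pi.single k (min r 0) : Fin P.K → ℝ) l * w l = min r 0 * w k := by
      intro w
      rw [Finset.sum_eq_single_of_mem k (Finset.mem_univ k)]
      · simp
      · intro l _ hl
        simp [hl]
    rw [hsingle (fun l => |β l|), hsingle] at hle
    have hcell := intervalIntegrable_cell hΔ hS.horizon hI (k := k) le_rfl ht.1 ht.2
    have h1 : ∀ s ∈ Icc (((k : ℕ) : ℝ) * P.Δt) t, |extendZero δ s| ≤ 1 := fun s hs =>
      abs_extendZero_le_one hδ.1 (cell_subset_horizon hΔ hS.horizon k ⟨hs.1, hs.2.trans ht.2⟩)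
    have hlow := le_integral_storageRate hS.ηplus_mem hS.ηminus_mem (hb k) (hr k) ht.1 hcell h1
    set w := ∫ s in (((k : ℕ) : ℝ) * P.Δt)..t, |extendZero δ s| with hw_def
    have hw0 : 0 ≤ w := intervalIntegral.integral_nonneg ht.1 fun _ _ => abs_nonneg _
    have hw1 : w ≤ t - ((k : ℕ) : ℝ) * P.Δt := by
      have := intervalIntegral.integral_mono_on ht.1 hcell.abs intervalIntegrable_const h1
      rwa [intervalIntegral.integral_const, smul_eq_mul, mul_one] at this
    have hwa : w ≤ P.Δt * P.absAverage (extendZero δ) k := by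
      rw [mul_absAverage hΔ]
      exact intervalIntegral.integral_mono_interval le_rfl ht.1 ht.2
        (Filter.Eventually.of_forall fun _ => abs_nonneg _)
        (intervalIntegrable_cell hΔ hS.horizon hI (k := k) le_rfl (ht.1.trans ht.2) le_rfl).abs
    -- Since `w` is at most the elapsed time, the base charge compensates its share in the chord,
    -- leaving the lower bound `w * r`.
    have hxb : P.ηplus * xb k * w ≤ P.ηplus * xb k * (t - ((k : ℕ) : ℝ) * P.Δt) :=
      mul_le_mul_of_nonneg_left hw1 (mul_nonneg hS.ηplus_mem.1.le (hb k))
    have hrw : min r 0 * (P.Δt * P.absAverage (extendZero δ) k) ≤ w * r := by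
      calc min r 0 * (P.Δt * P.absAverage (extendZero δ) k) ≤ min r 0 * w :=
            mul_le_mul_of_nonpos_left hwa (min_le_right _ _)
        _ ≤ r * w := mul_le_mul_of_nonneg_right (min_le_left _ _) hw0
        _ = w * r := mul_comm _ _
    have hmain : P.socK dK xb xr β y₀ k + P.Δt * (min r 0 * |β k|)
        ≤ P.soc (P.lift xb) (P.lift xr) δ y₀ (((k : ℕ) : ℝ) * P.Δt)
          + ((∫ s in (((k : ℕ) : ℝ) * P.Δt)..t,
            storageRate P.ηplus P.ηminus (xb k) (xr k) (extendZero δ s))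
          - (t - ((k : ℕ) : ℝ) * P.Δt) * dK k) := by
      rw [hk]
      linarith
    refine ⟨β, hβ, ?_⟩
    -- The extra term is exactly the change over interval `k` if `β k = -1` and `r ≤ 0`, and zero
    -- otherwise; this decides between the two grid points.
    by_cases hcase : β k = -1 ∧ r ≤ 0
    · right
      refine le_trans (le_of_eq ?_) hmain
      rw [socK_eq, prefixSum_succ, mul_add, ← add_assoc, ← socK_eq, hk, hcase.1,
        min_eq_left hcase.2]
      simp [hr_def]
    · left
      refine le_trans (le_of_eq ?_) hmain
      rcases hβ01 k with h | h
      · simp [h]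
      · have hr0 : 0 ≤ r := by
          by_contra hneg
          exact hcase ⟨h, (not_le.1 hneg).le⟩
        simp [min_eq_right hr0]
  -- While driving, consumption alone acts, so the end of the interval lies below the present state.
  · obtain ⟨β, hβ, h⟩ := exists_socK_le_soc_grid hS hd hb hr hδ y₀ (Nat.succ_le_of_lt k.2)
    refine ⟨β, hβ, Or.inr (h.trans ?_)⟩
    have hend : (((k : ℕ).succ : ℕ) : ℝ) * P.Δt
        ∈ Icc (((k : ℕ) : ℝ) * P.Δt) ((((k : ℕ) : ℝ) + 1) * P.Δt) := by
      rw [Nat.cast_succ]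
      exact ⟨by gcongr; linarith, le_rfl⟩
    rw [soc_mem_cell hΔ hS.horizon hd hI y₀ hend]
    simp only [hk1, hk2, storageRate_zero_zero, intervalIntegral.integral_zero]
    have h2 : (t - ((k : ℕ) : ℝ) * P.Δt) * dK k
        ≤ ((((k : ℕ).succ : ℕ) : ℝ) * P.Δt - ((k : ℕ) : ℝ) * P.Δt) * dK k := by
      refine mul_le_mul_of_nonneg_right ?_ (dK_nonneg hS hd k)
      rw [Nat.cast_succ]
      linarith [ht.2]
    linarith

end Bounds

/-! ### Equivalence of feasible sets and objectives -/

section Equivalence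

variable {dK yplusK yminusK : Fin P.K → ℝ}

lemma mem_XK_iff (hS : P.Standing) (hC : P.PiecewiseConstant dK yplusK yminusK)
    {v : Fin P.K → ℝ} : v ∈ P.XK ↔ P.lift v ∈ P.X := by
  constructor
  · rintro ⟨x, hx, rfl⟩
    obtain ⟨w, rfl⟩ := hC.bids x hx
    rwa [average_lift hS.Δt_pos hS.horizon]
  · exact fun h => ⟨_, h, average_lift hS.Δt_pos hS.horizon v⟩

lemma nonneg_of_mem_XK (hS : P.Standing) (hC : P.PiecewiseConstant dK yplusK yminusK)
    {v : Fin P.K → ℝ} (hv : v ∈ P.XK) (k : Fin P.K) : 0 ≤ v k := by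
  obtain ⟨t, ht⟩ := exists_lift_apply_eq hS.Δt_pos hS.horizon k
  rw [← ht v]
  exact (hS.X_sub ((mem_XK_iff hS hC).1 hv)).1 t

/-- The penalty is continuous on a compact set of scenarios, which contains the zero deviation. -/
lemma exists_isGreatest_penaltiesK (hS : P.Standing) (hD : P.Divisible)
    (dK xb xr : Fin P.K → ℝ) : ∃ z, IsGreatest (P.penaltiesK dK xb xr) z := by
  have hcpt : IsCompact (P.DhatK ×ˢ P.Y0hat) :=
    (isCompact_deviationSetK _ _ _).prod isCompact_Icc
  have hcont : Continuous fun q : (Fin P.K → ℝ) × ℝ =>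
      P.pstar * |P.socK dK xb xr q.1 q.2 P.K - P.ystar| := by
    unfold socK chargeRate dischargeRate
    fun_prop
  have himage : (fun q : (Fin P.K → ℝ) × ℝ =>
      P.pstar * |P.socK dK xb xr q.1 q.2 P.K - P.ystar|) '' (P.DhatK ×ˢ P.Y0hat)
      = P.penaltiesK dK xb xr := by
    ext z
    constructor
    · rintro ⟨⟨δ, y⟩, ⟨hδ, hy⟩, rfl⟩
      exact ⟨δ, hδ, y, hy, rfl⟩
    · rintro ⟨δ, hδ, y, hy, rfl⟩
      exact ⟨(δ, y), ⟨hδ, hy⟩, rfl⟩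
  rw [← himage]
  refine (hcpt.image hcont).exists_isGreatest (Set.Nonempty.image _ ?_)
  obtain ⟨n, -, hn⟩ := hD.Γhat_mul
  obtain ⟨m, -, hm⟩ := hD.γhat_mul
  refine ⟨(0, P.y0lowHat), ?_, left_mem_Icc.2 hS.Y0hat_nonempty⟩
  change (0 : Fin P.K → ℝ) ∈ deviationSetK P.K P.Δt P.Γhat P.γhat
  rw [hn, hm]
  exact zero_mem_deviationSetK hS.Δt_pos n m

/-- The worst penalty over all deviation trajectories is attained at a lifted vector. -/
lemma isGreatest_penalties_lift (hS : P.Standing) (hC : P.PiecewiseConstant dK yplusK yminusK)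
    (hD : P.Divisible) {xb xr : Fin P.K → ℝ} (hb : xb ∈ P.XK) (hr : xr ∈ P.XK) {z : ℝ}
    (hz : IsGreatest (P.penaltiesK dK xb xr) z) :
    IsGreatest (P.penalties (P.lift xb) (P.lift xr)) z := by
  obtain ⟨n, -, hn⟩ := hD.Γhat_mul
  obtain ⟨m, -, hm⟩ := hD.γhat_mul
  have hDK : P.DhatK = deviationSetK P.K P.Δt (n * P.Δt) (m * P.Δt) := by rw [DhatK, hn, hm]
  have hDc : P.Dhat = deviationSet P.T (n * P.Δt) (m * P.Δt) := by rw [Dhat, hn, hm]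
  have hΔ := hS.Δt_pos
  obtain ⟨⟨β, hβ, y₀, hy₀, rfl⟩, hmax⟩ := hz
  refine ⟨⟨P.lift β, ?_, y₀, hy₀, ?_⟩, ?_⟩
  · rw [hDc]
    rw [hDK] at hβ
    exact lift_mem_deviationSet hΔ hS.horizon hS.K_pos hβ
  · rw [hDK, mem_deviationSetK_iff hΔ] at hβ
    have := soc_lift_grid (xb := xb) (xr := xr) hΔ hS.horizon hC.d_eq hS.K_pos hβ.1 y₀ le_rfl
    rw [← hS.horizon] at this
    rw [this]
  · rintro _ ⟨δ, hδ, y, hy, rfl⟩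
    rw [hDc] at hδ
    have hb0 := nonneg_of_mem_XK hS hC hb
    have hr0 := nonneg_of_mem_XK hS hC hr
    obtain ⟨ζ, hζ, hlow⟩ := exists_socK_le_soc_grid hS hC.d_eq hb0 hr0 hδ y le_rfl
    have hupp := soc_grid_le_socK hS hC.d_eq hb0 hr0 hδ y le_rfl
    rw [← hS.horizon] at hlow hupp
    have h1 := hmax ⟨ζ, hDK ▸ hζ, y, hy, rfl⟩
    have h2 := hmax ⟨_, hDK ▸ absAverage_mem_deviationSetK hS hδ, y, hy, rfl⟩
    -- The absolute value on an interval is largest at an end point, and both end points here are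
    -- discrete terminal states.
    refine le_trans (mul_le_mul_of_nonneg_left (abs_le_max_abs_abs
      (sub_le_sub_right hlow _) (sub_le_sub_right hupp _)) hS.pstar_nonneg) ?_
    rw [mul_max_of_nonneg _ _ hS.pstar_nonneg]
    exact max_le h1 h2

/-- While driving, feasible bids vanish. -/
lemma bids_eq_zero_of_driving (hS : P.Standing) (hC : P.PiecewiseConstant dK yplusK yminusK)
    {n m : ℕ} (hm : 0 < m) {xb xr : Fin P.K → ℝ}
    (hp : ∀ δ ∈ deviationSetK P.K P.Δt (n * P.Δt) (m * P.Δt), ∀ k,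
      chargeRate (xb k) (xr k) (δ k) ≤ yplusK k)
    (hq : ∀ δ ∈ deviationSetK P.K P.Δt (n * P.Δt) (m * P.Δt), ∀ k,
      dischargeRate (xb k) (xr k) (δ k) ≤ yminusK k)
    (hd0 : ∀ k, 0 ≤ dK k) (k : Fin P.K) : dK k = 0 ∨ xb k = 0 ∧ xr k = 0 := by
  rcases (hd0 k).eq_or_lt' with h | h
  · exact Or.inl h
  right
  obtain ⟨t, ht⟩ := exists_lift_apply_eq hS.Δt_pos hS.horizon k
  obtain ⟨h1, h2⟩ := hS.driving t (by rw [hC.d_eq, ht]; exact h)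
  rw [hC.yplus_eq, ht] at h1
  rw [hC.yminus_eq, ht] at h2
  -- With both power limits zero, `xb k + z * xr k` has neither positive nor negative part for any
  -- admissible deviation `z`; `z = 0` and `z = 1` then determine both bids.
  have key : ∀ z : ℝ, |z| ≤ 1 → xb k + z * xr k = 0 := by
    intro z hz
    have hmem := single_mem_deviationSetK hS.Δt_pos (n := n) hm k hz
    have e1 := hp _ hmem k
    have e2 := hq _ hmem k
    rw [Pi.single_eq_same, h1, chargeRate] at e1
    rw [Pi.single_eq_same, h2, dischargeRate] at e2
    linarith [le_max_left (xb k + z * xr k) 0, le_max_left (-(xb k + z * xr k)) 0]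
  have k0 := key 0 (by simp)
  have k1 := key 1 (by simp)
  constructor <;> linarith

/-- Continuous feasibility is tested on lifted scenarios in one direction. In the other, power
limits reduce to one-interval scenarios, the upper state limit to averaged scenarios and the lower
one to rounded scenarios. -/
lemma liftPair_mem_feasible_iff (hS : P.Standing)
    (hC : P.PiecewiseConstant dK yplusK yminusK) (hD : P.Divisible)
    (x : (Fin P.K → ℝ) × (Fin P.K → ℝ)) :
    P.liftPair x ∈ P.feasible ↔ x ∈ P.feasibleK dK yplusK yminusK := by
  obtain ⟨xb, xr⟩ := x
  obtain ⟨n, -, hn⟩ := hD.Γ_mul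
  obtain ⟨m, hm0, hm⟩ := hD.γ_mul
  have hDK : P.DK = deviationSetK P.K P.Δt (n * P.Δt) (m * P.Δt) := by rw [DK, hn, hm]
  have hDc : P.D = deviationSet P.T (n * P.Δt) (m * P.Δt) := by rw [D, hn, hm]
  have hΔ := hS.Δt_pos
  have hK := hS.K_pos
  simp only [feasible, feasibleK, liftPair, mem_ofPred_eq, mem_XK_iff hS hC, hDK, hDc]
  refine and_congr_right fun hXb => and_congr_right fun hXr => ?_
  have hb0 := nonneg_of_mem_XK hS hC ((mem_XK_iff hS hC).2 hXb)
  have hr0 := nonneg_of_mem_XK hS hC ((mem_XK_iff hS hC).2 hXr)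
  constructor
  · rintro ⟨h1, h2, h3, h4⟩
    have hsoc : ∀ β ∈ deviationSetK P.K P.Δt (n * P.Δt) (m * P.Δt), ∀ k ≤ P.K, ∀ y₀,
        P.soc (P.lift xb) (P.lift xr) (P.lift β) y₀ (k * P.Δt) = P.socK dK xb xr β y₀ k :=
      fun β hβ k hk y₀ => soc_lift_grid hΔ hS.horizon hC.d_eq hK
        ((mem_deviationSetK_iff hΔ n m β).1 hβ).1 y₀ hk
    refine ⟨fun β hβ k => ?_, fun β hβ k => ?_, fun β hβ k hk y₀ hy₀ => ?_,
      fun β hβ k hk y₀ hy₀ => ?_⟩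
    · obtain ⟨t, ht⟩ := exists_lift_apply_eq hΔ hS.horizon k
      have := h1 _ (lift_mem_deviationSet hΔ hS.horizon hK hβ) t
      rwa [hC.yplus_eq, ht, ht, ht, ht] at this
    · obtain ⟨t, ht⟩ := exists_lift_apply_eq hΔ hS.horizon k
      have := h2 _ (lift_mem_deviationSet hΔ hS.horizon hK hβ) t
      rwa [hC.yminus_eq, ht, ht, ht, ht] at this
    · rw [← hsoc β hβ k hk y₀]
      exact h3 _ (lift_mem_deviationSet hΔ hS.horizon hK hβ)
        ⟨_, by positivity, grid_le_horizon hΔ hS.horizon hk⟩ y₀ hy₀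
    · rw [← hsoc β hβ k hk y₀]
      exact h4 _ (lift_mem_deviationSet hΔ hS.horizon hK hβ)
        ⟨_, by positivity, grid_le_horizon hΔ hS.horizon hk⟩ y₀ hy₀
  · rintro ⟨h1, h2, h3, h4⟩
    have hdrive := bids_eq_zero_of_driving hS hC hm0 h1 h2
      (dK_nonneg hS hC.d_eq)
    refine ⟨fun δ hδ t => ?_, fun δ hδ t => ?_, fun δ hδ t y₀ hy₀ => ?_,
      fun δ hδ t y₀ hy₀ => ?_⟩
    · obtain ⟨k, hk⟩ := exists_mem_tradingInterval hΔ hS.horizon hK t.2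
      -- The value of `δ` at the single time `t` is placed in interval `k` alone; averages would not
      -- control pointwise power.
      have hmem := single_mem_deviationSetK hΔ (n := n) hm0 k (abs_le.2 (hδ.1.1 t))
      have := h1 _ hmem k
      rw [Pi.single_eq_same] at this
      rwa [hC.yplus_eq, lift_apply hΔ _ hk, lift_apply hΔ _ hk, lift_apply hΔ _ hk]
    · obtain ⟨k, hk⟩ := exists_mem_tradingInterval hΔ hS.horizon hK t.2
      have hmem := single_mem_deviationSetK hΔ (n := n) hm0 k (abs_le.2 (hδ.1.1 t))
      have := h2 _ hmem k
      rw [Pi.single_eq_same] at this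
      rwa [hC.yminus_eq, lift_apply hΔ _ hk, lift_apply hΔ _ hk, lift_apply hΔ _ hk]
    · obtain ⟨k, hk⟩ := exists_mem_cell hΔ hS.horizon hK t.2
      have hmem := absAverage_mem_deviationSetK hS hδ
      rcases soc_le_socK hS hC.d_eq hb0 hr0 hδ hdrive y₀ hk with h | h
      · exact h.trans (h3 _ hmem k k.2.le y₀ hy₀)
      · exact h.trans (h3 _ hmem (k + 1) k.2 y₀ hy₀)
    · obtain ⟨k, hk⟩ := exists_mem_cell hΔ hS.horizon hK t.2
      obtain ⟨β, hβ, h | h⟩ := exists_socK_le_soc hS hC.d_eq hb0 hr0 hδ hdrive y₀ hk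
      · exact (h4 _ hβ k k.2.le y₀ hy₀).trans h
      · exact (h4 _ hβ (k + 1) k.2 y₀ hy₀).trans h

lemma bijOn_feasible (hS : P.Standing) (hC : P.PiecewiseConstant dK yplusK yminusK)
    (hD : P.Divisible) : BijOn P.liftPair (P.feasibleK dK yplusK yminusK) P.feasible := by
  refine ⟨fun x hx => (liftPair_mem_feasible_iff hS hC hD x).2 hx, ?_, ?_⟩
  · intro x _ x' _ h
    exact Prod.ext (lift_injective hS.Δt_pos hS.horizon (congrArg Prod.fst h))
      (lift_injective hS.Δt_pos hS.horizon (congrArg Prod.snd h))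
  · rintro ⟨x, x'⟩ hx
    obtain ⟨v, rfl⟩ := hC.bids x hx.1
    obtain ⟨v', rfl⟩ := hC.bids x' hx.2.1
    exact ⟨(v, v'), (liftPair_mem_feasible_iff hS hC hD (v, v')).1 hx, rfl⟩

lemma objective_liftPair (hS : P.Standing) (hC : P.PiecewiseConstant dK yplusK yminusK)
    (hD : P.Divisible) {xb xr : Fin P.K → ℝ} (hb : xb ∈ P.XK) (hr : xr ∈ P.XK) :
    P.objective (P.liftPair (xb, xr)) = P.objectiveK dK (xb, xr) := by
  obtain ⟨z, hz⟩ := exists_isGreatest_penaltiesK hS hD dK xb xr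
  simp only [objective, objectiveK, liftPair, costK]
  rw [hz.csSup_eq, (isGreatest_penalties_lift hS hC hD hb hr hz).csSup_eq]

end Equivalence

end Data

end VehicleToGrid

end

/-! ### The lossless discretization theorem -/

theorem theorem1 (P : VehicleToGrid.Data) (dK yplusK yminusK : Fin P.K → ℝ)
    (hS : P.Standing) (hC : P.PiecewiseConstant dK yplusK yminusK) (hD : P.Divisible) :
    -- the inner maxima of both problems are attained
    (∀ xb ∈ P.X, ∀ xr ∈ P.X,
      IsGreatest (P.penalties xb xr) (sSup (P.penalties xb xr))) ∧
    (∀ xb ∈ P.XK, ∀ xr ∈ P.XK,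
      IsGreatest (P.penaltiesK dK xb xr) (sSup (P.penaltiesK dK xb xr))) ∧
    -- lifting is a bijection between the feasible sets and preserves the objective value
    Set.BijOn P.liftPair (P.feasibleK dK yplusK yminusK) P.feasible ∧
    (∀ xb ∈ P.XK, ∀ xr ∈ P.XK,
      P.objective (P.liftPair (xb, xr)) = P.objectiveK dK (xb, xr)) ∧
    -- the optimal values agree and lifting is a bijection between the sets of optimal solutions
    P.optValue = P.optValueK dK yplusK yminusK ∧
    Set.BijOn P.liftPair (P.solutionsK dK yplusK yminusK) P.solutions := by
  have hbij := VehicleToGrid.Data.bijOn_feasible hS hC hD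
  have hobj : ∀ x ∈ P.feasibleK dK yplusK yminusK,
      P.objective (P.liftPair x) = P.objectiveK dK x := fun x hx =>
    VehicleToGrid.Data.objective_liftPair hS hC hD hx.1 hx.2.1
  refine ⟨?_, ?_, hbij, fun xb hb xr hr =>
    VehicleToGrid.Data.objective_liftPair hS hC hD hb hr, ?_, ?_⟩
  · intro xb hb xr hr
    obtain ⟨v, rfl⟩ := hC.bids xb hb
    obtain ⟨w, rfl⟩ := hC.bids xr hr
    obtain ⟨z, hz⟩ := VehicleToGrid.Data.exists_isGreatest_penaltiesK hS hD dK v w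
    have h := VehicleToGrid.Data.isGreatest_penalties_lift hS hC hD
      ((VehicleToGrid.Data.mem_XK_iff hS hC).2 hb) ((VehicleToGrid.Data.mem_XK_iff hS hC).2 hr) hz
    rwa [h.csSup_eq]
  · intro xb _ xr _
    obtain ⟨z, hz⟩ := VehicleToGrid.Data.exists_isGreatest_penaltiesK hS hD dK xb xr
    rwa [hz.csSup_eq]
  · rw [VehicleToGrid.Data.optValue, VehicleToGrid.Data.optValueK, ← hbij.image_eq, iInf_image]
    exact iInf_congr fun x => iInf_congr fun hx => by rw [hobj x hx]
  · refine ⟨?_, hbij.injOn.mono fun x hx => hx.1, ?_⟩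
    · rintro x ⟨hx, hmin⟩
      refine ⟨hbij.mapsTo hx, fun x' hx' => ?_⟩
      obtain ⟨y, hy, rfl⟩ := hbij.surjOn hx'
      rw [hobj x hx, hobj y hy]
      exact hmin y hy
    · rintro x ⟨hx, hmin⟩
      obtain ⟨y, hy, rfl⟩ := hbij.surjOn hx
      refine ⟨y, ⟨hy, fun y' hy' => ?_⟩, rfl⟩
      rw [← hobj y hy, ← hobj y' hy']
      exact hmin _ (hbij.mapsTo hy')
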